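/- For each $N\ge 1$ let $x^{(N)}_{ij}$, $1\le i,j\le N$, be independent complex random variables (whose laws, and whose underlying probability space, may depend on $N$) with $$\mathbb{E}\,x^{(N)}_{ij}=0,\qquad \mathbb{E}|x^{(N)}_{ij}|^2=1,\qquad \mathbb{E}|x^{(N)}_{ij}|^4\le B$$ for all $N,i,j$, with some $B<\infty$ independent of $N,i,j$, and assume that for every $\alpha>0$ $$L_N(\alpha)=N^{-2}\sum_{1\le i,j\le N}\mathbb{E}\Big[|x^{(N)}_{ij}|^4\,\mathbb{I}\{|x^{(N)}_{ij}|>\alpha\sqrt N\}\Big]\to 0\qquad (N\to\infty).$$ Let $\mathbf{X}=(N^{-1/2}x^{(N)}_{ij})_{1\le i,j\le N}$, let $m\ge 1$ be an integer, let $\lambda_1,\dots,\lambda_N$ be the eigenvalues, counted with multiplicity, of the Hermitian matrix $\mathbf{X}^m(\mathbf{X}^*)^m$, and let $F^{(m)}_N(t)=N^{-1}\sum_{k=1}^N\mathbb{I}\{\lambda_k\le t\}$ be their empirical distribution function. Then for every $t\in\mathbb{R}$ the limit $G^{(m)}(t)=\lim_{N\to\infty}\mathbb{E}F^{(m)}_N(t)$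 exists. The function $G^{(m)}$ depends only on $m$, it is a probability distribution function (non-decreasing, right-continuous, with limits $0$ at $-\infty$ and $1$ at $+\infty$), and all its moments are finite and equal to the Fuss--Catalan numbers: for every integer $p\ge 0$, $$\int_{\mathbb{R}}t^p\,dG^{(m)}(t)=\frac{1}{mp+1}\binom{mp+p}{p}.$$ -/

import Mathlib

open MeasureTheory ProbabilityTheory Filter Topology

/-- The normalised `N × N` random matrix `X = (N^{-1/2} x_{ij})`, at the sample point `ω`. -/
noncomputable def normalizedMatrix {Ω : Type*} {N : ℕ} (x : Fin N → Fin N → Ω → ℂ) (ω : Ω) :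
    Matrix (Fin N) (Fin N) ℂ :=
  Matrix.of fun i j => (((Real.sqrt N)⁻¹ : ℝ) : ℂ) * x i j ω

/-- The matrix `X^m (X^*)^m`. -/
def powerMatrix {N : ℕ} (m : ℕ) (X : Matrix (Fin N) (Fin N) ℂ) : Matrix (Fin N) (Fin N) ℂ :=
  X ^ m * X.conjTranspose ^ m

theorem powerMatrix_isHermitian {N : ℕ} (m : ℕ) (X : Matrix (Fin N) (Fin N) ℂ) :
    (powerMatrix m X).IsHermitian := by
  unfold powerMatrix
  rw [← Matrix.conjTranspose_pow]
  exact Matrix.isHermitian_mul_conjTranspose_self _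

/-- The empirical spectral distribution function of a Hermitian `N × N` matrix:
the proportion of eigenvalues (counted with multiplicity) that are at most `t`. -/
noncomputable def empiricalSpectralDistribution {N : ℕ} {A : Matrix (Fin N) (Fin N) ℂ}
    (hA : A.IsHermitian) (t : ℝ) : ℝ :=
  (N : ℝ)⁻¹ * ∑ k : Fin N, Set.indicator {s : ℝ | s ≤ t} (fun _ => (1 : ℝ)) (hA.eigenvalues k)

/-- The expectation `E F_N^{(m)}(t)` of the empirical spectral distribution function of
`X^m (X^*)^m`, where `X = (N^{-1/2} x_{ij})`. -/
noncomputable def expectedESD {Ω : Type*} [MeasurableSpace Ω] (P : Measure Ω) {N : ℕ}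
    (x : Fin N → Fin N → Ω → ℂ) (m : ℕ) (t : ℝ) : ℝ :=
  ∫ ω, empiricalSpectralDistribution (powerMatrix_isHermitian m (normalizedMatrix x ω)) t ∂P

/-- `L_N(α) = N^{-2} ∑_{i,j} E |x_{ij}|^4 1{|x_{ij}| > α √N}`. -/
noncomputable def lindebergFourth {Ω : Type*} [MeasurableSpace Ω] (P : Measure Ω) {N : ℕ}
    (x : Fin N → Fin N → Ω → ℂ) (α : ℝ) : ℝ :=
  ((N : ℝ) ^ 2)⁻¹ * ∑ i : Fin N, ∑ j : Fin N,
    ∫ ω, Set.indicator {ω' | α * Real.sqrt N < ‖x i j ω'‖} (fun ω' => ‖x i j ω'‖ ^ 4) ω ∂P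

/-- The assumptions on the entries. For each `N` the `x N i j` are independent complex random
variables on a probability space that may vary with `N`, centred, of unit variance, with fourth
moments bounded uniformly in `i`, `j`, `N`, and satisfying the Lindeberg-type condition. -/
structure EntryConditions {Ω : ℕ → Type*} [∀ N, MeasurableSpace (Ω N)]
    (P : ∀ N, Measure (Ω N)) (x : ∀ N, Fin N → Fin N → Ω N → ℂ) : Prop where
  measurable : ∀ N i j, Measurable (x N i j)
  indep : ∀ N, iIndepFun (fun ij : Fin N × Fin N => x N ij.1 ij.2) (P N)
  mean : ∀ N i j, ∫ ω, x N i j ω ∂(P N) = 0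
  variance : ∀ N i j, ∫ ω, ‖x N i j ω‖ ^ 2 ∂(P N) = 1
  fourth : ∃ B : ℝ, ∀ N i j,
    Integrable (fun ω => ‖x N i j ω‖ ^ 4) (P N) ∧ ∫ ω, ‖x N i j ω‖ ^ 4 ∂(P N) ≤ B
  lindeberg : ∀ α : ℝ, 0 < α → Tendsto (fun N => lindebergFourth (P N) (x N) α) atTop (𝓝 0)

/-!
Truncating the entries at level `α_N √N` with `α_N → 0` slowly changes `E F_N` by at most
`L_N(α_N) / α_N⁴`. Expanding the expected trace of a word in `X` and `X*` over closed walks in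
`{1, …, N}`, only the walks that explore a tree, crossing each edge once in each direction, survive
in the limit. Read with a stack, they are the noncrossing matchings of the word; for
`(X^m (X*)^m)^p` their number satisfies the recursion for the coefficients of the powers of the
series `F = 1 + z F^(m+1)`, so it is the Fuss–Catalan number. These numbers are the moments of a
scaled product of independent beta variables, whose law has compact support and no atoms, and hence
convergence of moments gives convergence of the distribution functions at every point.
-/

/-! ### Raney numbers and stack words -/

/-- The Fuss–Catalan numbers, in the closed form in which they appear as moments. -/
noncomputable def fussCatalan (m p : ℕ) : ℝ :=
  1 / ((m : ℝ) * (p : ℝ) + 1) * (Nat.choose (m * p + p) p : ℝ)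

/-- Raney numbers: the coefficient of `z ^ n` in `F ^ r`, where `F = 1 + z F ^ (m + 1)`. The
recursion is the coefficient form of `F ^ (r + 1) = F ^ r + z F ^ (r + m + 1)`. -/
def raney (m : ℕ) : ℕ → ℕ → ℕ
  | 0, _ => 1
  | _ + 1, 0 => 0
  | n + 1, r + 1 => raney m (n + 1) r + raney m n (r + m + 1)

theorem raney_mul (m n r : ℕ) :
    raney m n r * ((m + 1) * n + r) = r * ((m + 1) * n + r).choose n := by
  induction n generalizing r with
  | zero => simp [raney]
  | succ n ihn =>
    induction r with
    | zero => simp [raney]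
    | succ r ihr =>
      have hfewer := ihn (r + m + 1)
      rw [show (m + 1) * n + (r + m + 1) = (m + 1) * (n + 1) + r by ring] at hfewer
      set k := (m + 1) * (n + 1) + r with hk
      have hchoose : k.choose (n + 1) * (n + 1) = k.choose n * (k - n) :=
        Nat.choose_succ_right_eq k n
      have hnk : n ≤ k := by nlinarith
      have hpos : 0 < k := by positivity
      rw [raney, ← add_assoc, ← hk, Nat.choose_succ_succ]
      refine Nat.eq_of_mul_eq_mul_left hpos ?_
      zify [hnk] at hk hchoose ihr hfewer ⊢
      linear_combination (k + 1 : ℤ) * ihr + (k + 1 : ℤ) * hfewer - (m + 1 : ℤ) * hchoose -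
        (k.choose n + k.choose (n + 1) : ℤ) * hk

theorem raney_one (m p : ℕ) : (raney m p 1 : ℝ) = fussCatalan m p := by
  have hraney : raney m p 1 * (m * p + p + 1) = (m * p + p + 1).choose p := by
    simpa [add_mul] using raney_mul m p 1
  have hchoose : (m * p + p).choose p * (m * p + p + 1) =
      (m * p + p + 1).choose p * (m * p + 1) := by
    rw [Nat.choose_mul_succ_eq, show m * p + p + 1 - p = m * p + 1 by lia]
  have hmul : raney m p 1 * (m * p + 1) = (m * p + p).choose p :=
    Nat.eq_of_mul_eq_mul_right (show 0 < m * p + p + 1 by lia) (by rw [hchoose, ← hraney]; ring)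
  rw [fussCatalan, one_div, ← hmul]
  push_cast
  field_simp

/-- The coefficient of `z ^ n` in `z ^ t F ^ r`, where `F = 1 + z F ^ (m + 1)`. -/
def shiftedRaney (m n t r : ℕ) : ℕ :=
  if t ≤ n then raney m (n - t) r else 0

theorem shiftedRaney_succ (m n t r : ℕ) :
    shiftedRaney m n t (r + 1) =
      shiftedRaney m n t r + shiftedRaney m n (t + 1) (r + m + 1) := by
  simp only [shiftedRaney]
  rcases lt_trichotomy t n with h | rfl | h
  · obtain ⟨k, rfl⟩ := Nat.exists_eq_add_of_lt h
    rw [show t + k + 1 - t = k + 1 by lia, show t + k + 1 - (t + 1) = k by lia]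
    simp [raney, show t ≤ t + k + 1 by lia, show t + 1 ≤ t + k + 1 by lia]
  · simp [raney]
  · simp [show ¬t ≤ n by lia, show ¬t + 1 ≤ n by lia]

/-- The number of ways to read the word `w`, starting from the stack `s`, where each letter is
either pushed or cancels an opposite letter at the top of the stack, so that the stack is empty at
the end. With `s = []` this counts the noncrossing pairings of `w` matching opposite letters. -/
def stackCount : List Bool → List Bool → ℕ
  | [], s => if s = [] then 1 else 0
  | b :: w, s => stackCount w (b :: s) + if s.head? = some (!b) then stackCount w s.tail else 0

/-- The word `(a^m b^m)^n`, with `true` for `a` and `false` for `b`. The height of a position in it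
is the excess of the letters `a` over the letters `b` read before. -/
def blockWord (m n : ℕ) : List Bool :=
  (List.replicate n (List.replicate m true ++ List.replicate m false)).flatten

theorem blockWord_succ (m n : ℕ) : blockWord m (n + 1) =
    List.replicate m true ++ (List.replicate m false ++ blockWord m n) := by
  simp [blockWord, List.replicate_succ]

/-- The stacks that occur at height `h` while reading a block word: read from the top, the letters
describe, step by step backwards, a path inside `[0, m]` from height `0` to height `h`. -/
def IsStackPath (m : ℕ) : ℕ → List Bool → Prop
  | h, [] => h = 0
  | h, true :: s => 1 ≤ h ∧ IsStackPath m (h - 1) s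
  | h, false :: s => h + 1 ≤ m ∧ IsStackPath m (h + 1) s

/-- The exponent `r` in the generating function `z ^ t F ^ r` of the completions of a stack at
height `h` in block words; `d` is the direction of the next letter. -/
def completionExponent (m : ℕ) : (d : Bool) → (h : ℕ) → List Bool → ℕ
  | true, h, [] => m + 1 - h
  | false, _, [] => 1
  | true, h, true :: s => m + 1 - h + completionExponent m false (h - 1) s
  | false, h, true :: s => 1 + completionExponent m false (h - 1) s
  | true, h, false :: s => 1 + completionExponent m true (h + 1) s
  | false, h, false :: s => h + 1 + completionExponent m true (h + 1) s

/-- The exponent `t` in the generating function `z ^ t F ^ r` of the completions of a stack: the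
number of turns from down to up which emptying the stack forces. -/
def forcedTurns : (d : Bool) → List Bool → ℕ
  | _, [] => 0
  | _, true :: s => forcedTurns false s
  | true, false :: s => forcedTurns true s
  | false, false :: s => forcedTurns true s + 1

/-- The number of ways to empty the stack `s` at height `h` when `n` turns from down to up remain,
as given by its generating function. -/
def completionCount (m : ℕ) (d : Bool) (h n : ℕ) (s : List Bool) : ℕ :=
  shiftedRaney m n (forcedTurns d s) (completionExponent m d h s)

section StackCount

variable {m n h : ℕ} {s : List Bool}

-- If the top letter can be cancelled, this is `F ^ (r + 1) = F ^ r + z F ^ (r + m + 1)`.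
theorem completionCount_up (hh : h + 1 ≤ m) (hs : IsStackPath m h s) :
    completionCount m true h n s = completionCount m true (h + 1) n (true :: s) +
      if s.head? = some false then completionCount m true (h + 1) n s.tail else 0 := by
  match s, hs with
  | [], hs =>
    obtain rfl : h = 0 := hs
    simp [completionCount, forcedTurns, completionExponent]
  | true :: s, _ =>
    have hexp : m + 1 - (h + 1) + (1 + completionExponent m false (h - 1) s) =
        m + 1 - h + completionExponent m false (h - 1) s := by lia
    simp [completionCount, forcedTurns, completionExponent, ← hexp]
  | false :: s, _ =>
    have hexp : m + 1 - (h + 1) + (h + 1 + completionExponent m true (h + 1) s) =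
        completionExponent m true (h + 1) s + m + 1 := by lia
    simp only [completionCount, forcedTurns, completionExponent, Nat.add_sub_cancel, hexp]
    rw [add_comm 1, shiftedRaney_succ, add_comm]
    simp

theorem completionCount_down (hh : h + 1 ≤ m) (hs : IsStackPath m (h + 1) s) :
    completionCount m false (h + 1) n s = completionCount m false h n (false :: s) +
      if s.head? = some true then completionCount m false h n s.tail else 0 := by
  match s, hs with
  | true :: s, _ =>
    have hexp : h + 1 + (m + 1 - (h + 1) + completionExponent m false h s) =
        completionExponent m false h s + m + 1 := by lia
    simp only [completionCount, forcedTurns, completionExponent, Nat.add_sub_cancel, hexp]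
    rw [add_comm 1, shiftedRaney_succ, add_comm]
    simp
  | false :: s, _ => simp [completionCount, forcedTurns, completionExponent, ← add_assoc]

theorem completionCount_top (hm : 1 ≤ m) (hs : IsStackPath m m s) :
    completionCount m false m n s = completionCount m true m n s := by
  match s, hs with
  | [], hs => exact absurd hs (by simp only [IsStackPath]; lia)
  | true :: s, _ => simp [completionCount, forcedTurns, completionExponent]
  | false :: s, hs => exact absurd hs.1 (by lia)

theorem completionCount_bottom (hs : IsStackPath m 0 s) :
    completionCount m true 0 n s = completionCount m false 0 (n + 1) s := by
  match s, hs with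
  | [], _ =>
    cases n <;> simp [completionCount, shiftedRaney, forcedTurns, completionExponent, raney]
  | true :: s, hs => exact absurd hs.1 (by lia)
  | false :: s, _ => simp [completionCount, shiftedRaney, forcedTurns, completionExponent]

theorem completionCount_zero (hs : IsStackPath m 0 s) :
    completionCount m false 0 0 s = if s = [] then 1 else 0 := by
  match s, hs with
  | [], _ => simp [completionCount, shiftedRaney, forcedTurns, raney]
  | true :: s, hs => exact absurd hs.1 (by lia)
  | false :: s, _ => simp [completionCount, shiftedRaney, forcedTurns]

theorem IsStackPath.tail {b : Bool} (hs : IsStackPath m h s) (hb : s.head? = some b) :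
    IsStackPath m (if b then h - 1 else h + 1) s.tail := by
  match s, hs with
  | c :: s, hs =>
    obtain rfl : c = b := by simpa using hb
    cases c <;> exact hs.2

theorem stackCount_replicate_true_append {w : List Bool} (hm : 1 ≤ m)
    (hw : ∀ s, IsStackPath m m s → stackCount w s = completionCount m false m n s)
    {k : ℕ} (hk : k + h = m) (hs : IsStackPath m h s) :
    stackCount (List.replicate k true ++ w) s = completionCount m true h n s := by
  induction k generalizing h s with
  | zero =>
    obtain rfl : h = m := by lia
    simpa using (hw s hs).trans (completionCount_top hm hs)
  | succ k ih =>
    rw [List.replicate_succ, List.cons_append, stackCount, completionCount_up (by lia) hs,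
      ih (h := h + 1) (by lia) (by simpa [IsStackPath] using hs), Bool.not_true]
    split_ifs with hb
    · rw [ih (h := h + 1) (by lia) (by simpa using hs.tail hb)]
    · rfl

theorem stackCount_replicate_false_append {w : List Bool}
    (hw : ∀ s, IsStackPath m 0 s → stackCount w s = completionCount m false 0 n s)
    (hh : h ≤ m) (hs : IsStackPath m h s) :
    stackCount (List.replicate h false ++ w) s = completionCount m false h n s := by
  induction h generalizing s with
  | zero => simpa using hw s hs
  | succ h ih =>
    rw [List.replicate_succ, List.cons_append, stackCount, completionCount_down (by lia) hs,
      ih (by lia) (by simpa [IsStackPath] using ⟨by lia, hs⟩), Bool.not_false]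
    split_ifs with hb
    · rw [ih (by lia) (by simpa using hs.tail hb)]
    · rfl

theorem stackCount_blockWord_of_isStackPath (hm : 1 ≤ m) (hs : IsStackPath m 0 s) :
    stackCount (blockWord m n) s = completionCount m false 0 n s := by
  induction n generalizing s with
  | zero => simp [blockWord, stackCount, completionCount_zero hs]
  | succ n ih =>
    rw [blockWord_succ, stackCount_replicate_true_append hm
      (fun _ => stackCount_replicate_false_append (fun _ => ih) le_rfl) (add_zero m) hs,
      completionCount_bottom hs]

theorem stackCount_blockWord (hm : 1 ≤ m) (p : ℕ) :
    (stackCount (blockWord m p) [] : ℝ) = fussCatalan m p := by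
  rw [← raney_one, stackCount_blockWord_of_isStackPath hm (by simp [IsStackPath])]
  simp [completionCount, shiftedRaney, forcedTurns, completionExponent]

end StackCount

/-! ### Walks that explore a tree -/

section Walks

variable {V : Type*}

/-- The matrix position used by a step from `i` to `j`: letters `true` are traversed forwards and
letters `false` backwards. -/
def stepEdge (b : Bool) (i j : V) : V × V := if b then (i, j) else (j, i)

/-- The edges, with letters, used by the walk that starts at a vertex, reads a word and visits the
vertices of a list. -/
def walkSteps : List Bool → V → List V → List ((V × V) × Bool)
  | b :: w, c, j :: l => (stepEdge b c j, b) :: walkSteps w j l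
  | [], _, _ => []
  | _ :: _, _, [] => []

/-- The edges, with letters, of the path from the root to the current vertex `c` that is stored on
a stack; a stack entry is a vertex of the path together with the letter read when leaving it. -/
def stackSteps : V → List (V × Bool) → List ((V × V) × Bool)
  | _, [] => []
  | c, (p, b) :: st => (stepEdge b p c, b) :: stackSteps p st

theorem stepEdge_not (b : Bool) (i j : V) : stepEdge (!b) i j = stepEdge b j i := by
  cases b <;> rfl

theorem forall_stepEdge_iff {p : V → Prop} {b : Bool} {i j : V} :
    (p (stepEdge b i j).1 ∧ p (stepEdge b i j).2) ↔ p i ∧ p j := by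
  cases b <;> simp [stepEdge, and_comm]

theorem stepEdge_eq_stepEdge_iff {a b : Bool} {c j p : V} (hne : p ≠ c) :
    stepEdge b c j = stepEdge a p c ↔ j = p ∧ a = !b := by
  cases a <;> cases b <;> simp [stepEdge, hne, hne.symm, eq_comm]

theorem mem_of_mem_stackSteps {e : V × V} {c : V} {st : List (V × Bool)}
    (he : e ∈ (stackSteps c st).map Prod.fst) :
    e.1 ∈ c :: st.map Prod.fst ∧ e.2 ∈ c :: st.map Prod.fst := by
  induction st generalizing c with
  | nil => simp [stackSteps] at he
  | cons pb st ih =>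
    simp only [stackSteps, List.map_cons, List.mem_cons] at he
    rcases he with rfl | he
    · exact forall_stepEdge_iff.2 (by simp)
    · exact (ih he).imp (List.mem_cons_of_mem c) (List.mem_cons_of_mem c)

/-- The state of an exploration of a tree: `H` are the steps made so far, `S` the visited vertices,
`st` the stack, `c` the current vertex and `C` the edges traversed in both directions. -/
structure IsTreeState (H : List ((V × V) × Bool)) (S : Finset V) (st : List (V × Bool)) (c : V)
    (C : List (V × V)) : Prop where
  perm : H.Perm (stackSteps c st ++ (C.map (fun e => (e, true)) ++ C.map (fun e => (e, false))))
  nodup : ((stackSteps c st).map Prod.fst ++ C).Nodup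
  card : ((stackSteps c st).map Prod.fst ++ C).length + 1 = S.card
  mem : ∀ e ∈ (stackSteps c st).map Prod.fst ++ C, e.1 ∈ S ∧ e.2 ∈ S
  vertex_nodup : (c :: st.map Prod.fst).Nodup
  vertex_mem : ∀ v ∈ c :: st.map Prod.fst, v ∈ S

namespace IsTreeState

variable {H : List ((V × V) × Bool)} {S : Finset V} {st : List (V × Bool)} {c j : V}
  {C : List (V × V)}

theorem init (r : V) : IsTreeState [] {r} [] r [] := by
  constructor <;> simp [stackSteps]

theorem map_fst_perm (h : IsTreeState H S st c C) :
    (H.map Prod.fst).Perm ((stackSteps c st).map Prod.fst ++ (C ++ C)) := by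
  simpa [Function.comp_def] using h.perm.map Prod.fst

theorem mem_map_fst_iff (h : IsTreeState H S st c C) {e : V × V} :
    e ∈ H.map Prod.fst ↔ e ∈ (stackSteps c st).map Prod.fst ++ C := by
  rw [h.map_fst_perm.mem_iff]
  simp only [List.mem_append, or_self]

-- The other edges of the stack path avoid the current vertex, so only its last edge can be used.
theorem exists_stack_eq_cons (h : IsTreeState H S st c C) {b : Bool}
    (he : stepEdge b c j ∈ (stackSteps c st).map Prod.fst) : ∃ st', st = (j, !b) :: st' := by
  rcases st with _ | ⟨⟨p, a⟩, st⟩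
  · simp [stackSteps] at he
  · have hc : c ∉ p :: st.map Prod.fst := (List.nodup_cons.1 h.vertex_nodup).1
    rw [stackSteps, List.map_cons, List.mem_cons] at he
    rcases he with he | he
    · obtain ⟨rfl, rfl⟩ := (stepEdge_eq_stepEdge_iff (fun hpc => hc (by simp [hpc]))).1 he
      exact ⟨st, rfl⟩
    · exact absurd (forall_stepEdge_iff.1 (mem_of_mem_stackSteps he)).1 hc

theorem pop {b : Bool} (h : IsTreeState H S ((j, !b) :: st) c C) :
    IsTreeState (H ++ [(stepEdge b c j, b)]) S st j (stepEdge b c j :: C) := by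
  classical
  have hst : stackSteps c ((j, !b) :: st) = (stepEdge b c j, !b) :: stackSteps j st := by
    rw [stackSteps, stepEdge_not]
  have hmid : ((stackSteps c ((j, !b) :: st)).map Prod.fst ++ C).Perm
      ((stackSteps j st).map Prod.fst ++ stepEdge b c j :: C) := by
    rw [hst]
    exact List.perm_middle.symm
  refine ⟨?_, hmid.nodup_iff.1 h.nodup, hmid.length_eq ▸ h.card,
    fun e he => h.mem e (hmid.mem_iff.2 he), (List.nodup_cons.1 h.vertex_nodup).2,
    fun v hv => h.vertex_mem v (List.mem_cons_of_mem _ hv)⟩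
  refine (List.perm_append_singleton _ _).trans ((h.perm.cons _).trans ?_)
  rw [hst, List.perm_iff_count]
  intro x
  simp only [List.map_cons, List.cons_append, List.count_cons, List.count_append]
  cases b
  · simp only [Bool.not_false]; lia
  · simp only [Bool.not_true]; lia

variable [DecidableEq V]

theorem card_edges (h : IsTreeState H S st c C) :
    (H.map Prod.fst).toFinset.card + 1 = S.card := by
  have hset : (H.map Prod.fst).toFinset = ((stackSteps c st).map Prod.fst ++ C).toFinset := by
    ext e
    rw [List.mem_toFinset, List.mem_toFinset, h.mem_map_fst_iff]
  rw [hset, List.toFinset_card_of_nodup h.nodup, h.card]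

theorem count_of_mem_stack (h : IsTreeState H S st c C) {e : V × V}
    (he : e ∈ (stackSteps c st).map Prod.fst) : (H.map Prod.fst).count e = 1 := by
  have hnodup := List.nodup_append.1 h.nodup
  rw [h.map_fst_perm.count_eq, List.count_append, List.count_append,
    List.count_eq_one_of_mem hnodup.1 he,
    List.count_eq_zero_of_not_mem fun hC => hnodup.2.2 e he e hC rfl]

theorem two_le_count_of_mem_closed (h : IsTreeState H S st c C) {e : V × V} (he : e ∈ C) :
    2 ≤ (H.map Prod.fst).count e := by
  rw [h.map_fst_perm.count_eq, List.count_append, List.count_append]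
  have := List.count_pos_iff.2 he
  lia

theorem push (h : IsTreeState H S st c C) (b : Bool) (hj : j ∉ S) :
    IsTreeState (H ++ [(stepEdge b c j, b)]) (insert j S) ((c, b) :: st) j C where
  perm := (List.perm_append_singleton _ _).trans (h.perm.cons _)
  nodup := List.nodup_cons.2 ⟨fun hm => hj (forall_stepEdge_iff.1 (h.mem _ hm)).2, h.nodup⟩
  card := by
    rw [Finset.card_insert_of_notMem hj, ← h.card]
    simp [stackSteps]
  mem := by
    simp only [stackSteps, List.map_cons, List.cons_append, List.mem_cons]
    rintro e (rfl | he)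
    · exact forall_stepEdge_iff.2 (by simp [h.vertex_mem c])
    · exact (h.mem e he).imp Finset.mem_insert_of_mem Finset.mem_insert_of_mem
  vertex_nodup := List.nodup_cons.2 ⟨fun hm => hj (h.vertex_mem j hm), h.vertex_nodup⟩
  vertex_mem := List.forall_mem_cons.2 ⟨Finset.mem_insert_self j S, fun v hv =>
    Finset.mem_insert_of_mem (h.vertex_mem v hv)⟩

theorem stack_eq_nil_of_count_eq_two (h : IsTreeState H S st c C)
    (hcount : ∀ e ∈ H.map Prod.fst, (H.map Prod.fst).count e = 2) : st = [] := by
  rcases st with _ | ⟨⟨p, a⟩, st⟩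
  · rfl
  · have hp : stepEdge a p c ∈ (stackSteps c ((p, a) :: st)).map Prod.fst := by simp [stackSteps]
    have htwo := hcount _ (h.mem_map_fst_iff.2 (List.mem_append_left C hp))
    rw [h.count_of_mem_stack hp] at htwo
    contradiction

end IsTreeState

variable [DecidableEq V]

/-- The walk explores a tree: each step either goes to a new vertex (a push), or it goes back to
the parent of the current vertex with the letter opposite to the one used on the way out (a pop),
and the stack is empty at the end. -/
inductive IsTreeWalk : Finset V → List (V × Bool) → V → List Bool → List V → Prop
  | nil {S c} : IsTreeWalk S [] c [] []
  | push {S st c b w j l} (hj : j ∉ S) (h : IsTreeWalk (insert j S) ((c, b) :: st) j w l) :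
      IsTreeWalk S st c (b :: w) (j :: l)
  | pop {S st c b w j l} (hj : j ∈ S) (h : IsTreeWalk S st j w l) :
      IsTreeWalk S ((j, !b) :: st) c (b :: w) (j :: l)

section IsTreeWalk

variable {S : Finset V} {st : List (V × Bool)} {c j : V} {b : Bool} {w : List Bool} {l : List V}

theorem isTreeWalk_nil_iff : IsTreeWalk S st c [] [] ↔ st = [] :=
  ⟨fun h => by cases h; rfl, fun h => h ▸ .nil⟩

theorem isTreeWalk_cons_iff_of_notMem (hj : j ∉ S) :
    IsTreeWalk S st c (b :: w) (j :: l) ↔ IsTreeWalk (insert j S) ((c, b) :: st) j w l := by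
  refine ⟨fun h => ?_, .push hj⟩
  cases h with
  | push _ h => exact h
  | pop hj' _ => exact absurd hj' hj

theorem isTreeWalk_cons_iff_of_mem (hj : j ∈ S) :
    IsTreeWalk S st c (b :: w) (j :: l) ↔ st.head? = some (j, !b) ∧ IsTreeWalk S st.tail j w l := by
  constructor
  · intro h
    cases h with
    | push hj' _ => exact absurd hj hj'
    | pop _ h => exact ⟨rfl, h⟩
  · rcases st with _ | ⟨pa, st⟩
    · simp
    · rintro ⟨hpa, h⟩
      obtain rfl : pa = (j, !b) := by simpa using hpa
      exact .pop hj h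

theorem insert_union_toFinset (S : Finset V) (j : V) (l : List V) :
    insert j S ∪ l.toFinset = S ∪ (j :: l).toFinset := by
  simp [Finset.insert_union, Finset.union_insert]

theorem IsTreeWalk.exists_isTreeState {H : List ((V × V) × Bool)} {C : List (V × V)}
    (hw : IsTreeWalk S st c w l) (h : IsTreeState H S st c C) :
    ∃ C', IsTreeState (H ++ walkSteps w c l) (S ∪ l.toFinset) [] (l.getLastD c) C' := by
  induction hw generalizing H C with
  | nil => exact ⟨C, by simpa [walkSteps] using h⟩
  | push hj _ ih =>
    obtain ⟨C', h'⟩ := ih (h.push _ hj)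
    rw [List.append_assoc, insert_union_toFinset] at h'
    exact ⟨C', by rwa [List.getLastD_cons]⟩
  | pop hj _ ih =>
    obtain ⟨C', h'⟩ := ih h.pop
    rw [List.append_assoc] at h'
    refine ⟨C', ?_⟩
    rwa [List.getLastD_cons, ← insert_union_toFinset, Finset.insert_eq_of_mem hj]

/-- The bottom vertex of a stack, which is the starting point of the walk that led to it. -/
def stackRoot : V → List (V × Bool) → V
  | c, [] => c
  | _, (p, _) :: st => stackRoot p st

theorem IsTreeWalk.getLastD_eq (hw : IsTreeWalk S st c w l) : l.getLastD c = stackRoot c st := by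
  induction hw with
  | nil => rfl
  | push _ _ ih => rw [List.getLastD_cons, ih]; rfl
  | pop _ _ ih => rw [List.getLastD_cons, ih]; rfl

theorem IsTreeWalk.exists_perm {r : V} (h : IsTreeWalk {r} [] r w l) :
    l.getLastD r = r ∧ ∃ C : List (V × V), C.Nodup ∧ C.length + 1 = ({r} ∪ l.toFinset).card ∧
      (walkSteps w r l).Perm (C.map (fun e => (e, true)) ++ C.map (fun e => (e, false))) := by
  refine ⟨h.getLastD_eq, ?_⟩
  obtain ⟨C, hC⟩ := h.exists_isTreeState (IsTreeState.init r)
  exact ⟨C, by simpa [stackSteps] using hC.nodup, by simpa [stackSteps] using hC.card,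
    by simpa [stackSteps] using hC.perm⟩

end IsTreeWalk

-- Each step that reaches a new vertex uses a new edge.
theorem card_union_add_card_le {w : List Bool} {c : V} {l : List V} (hl : l.length = w.length)
    {S : Finset V} {E : Finset (V × V)} (hc : c ∈ S) (hE : ∀ e ∈ E, e.1 ∈ S ∧ e.2 ∈ S) :
    (S ∪ l.toFinset).card + E.card ≤
      S.card + (E ∪ ((walkSteps w c l).map Prod.fst).toFinset).card := by
  induction w generalizing c l S E with
  | nil =>
    obtain rfl : l = [] := by simpa using hl
    simp [walkSteps]
  | cons b w ih =>
    rcases l with _ | ⟨j, l⟩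
    · simp at hl
    have hstep : ((walkSteps (b :: w) c (j :: l)).map Prod.fst).toFinset =
        insert (stepEdge b c j) ((walkSteps w j l).map Prod.fst).toFinset := by simp [walkSteps]
    have hE' : ∀ e ∈ insert (stepEdge b c j) E, e.1 ∈ insert j S ∧ e.2 ∈ insert j S :=
      (Finset.forall_mem_insert ..).2 ⟨forall_stepEdge_iff.2 (by simp [hc]), fun e he =>
        (hE e he).imp Finset.mem_insert_of_mem Finset.mem_insert_of_mem⟩
    have hih := ih (by simpa using hl) (Finset.mem_insert_self j S) hE'
    rw [insert_union_toFinset, Finset.insert_union, ← Finset.union_insert, ← hstep] at hih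
    by_cases hj : j ∈ S
    · rw [Finset.insert_eq_of_mem hj] at hih
      have := Finset.card_le_card (Finset.subset_insert (stepEdge b c j) E)
      lia
    · have hnew : stepEdge b c j ∉ E := fun he => hj (forall_stepEdge_iff.1 (hE _ he)).2
      rw [Finset.card_insert_of_notMem hj, Finset.card_insert_of_notMem hnew] at hih
      lia

theorem IsTreeState.stepEdge_mem_of_card_lt {H : List ((V × V) × Bool)} {S : Finset V}
    {st : List (V × Bool)} {c j : V} {C : List (V × V)} {b : Bool} {w : List Bool} {l : List V}
    (h : IsTreeState H S st c C) (hl : l.length = w.length) (hj : j ∈ S)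
    (hcard : ((H ++ walkSteps (b :: w) c (j :: l)).map Prod.fst).toFinset.card <
      (S ∪ l.toFinset).card) :
    stepEdge b c j ∈ H.map Prod.fst := by
  by_contra hnew
  set E := insert (stepEdge b c j) (H.map Prod.fst).toFinset with hE
  have hES : ∀ e ∈ E, e.1 ∈ S ∧ e.2 ∈ S :=
    (Finset.forall_mem_insert ..).2 ⟨forall_stepEdge_iff.2 ⟨h.vertex_mem c (by simp), hj⟩,
      fun e he => h.mem e (h.mem_map_fst_iff.1 (List.mem_toFinset.1 he))⟩
  have hEcard : E.card = S.card := by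
    rw [hE, Finset.card_insert_of_notMem (by simpa using hnew), h.card_edges]
  have hunion : ((H ++ walkSteps (b :: w) c (j :: l)).map Prod.fst).toFinset =
      E ∪ ((walkSteps w j l).map Prod.fst).toFinset := by
    simp [hE, walkSteps, Finset.insert_union, Finset.union_insert]
  have := card_union_add_card_le hl hj hES
  rw [hunion] at hcard
  lia

-- A step to a visited vertex adds no vertex, hence no edge. The edges closed earlier have been used
-- twice, so the step uses an edge of the stack path, and therefore its last one.
theorem IsTreeState.isTreeWalk {H : List ((V × V) × Bool)} {S : Finset V} {st : List (V × Bool)}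
    {c : V} {C : List (V × V)} {w : List Bool} {l : List V} (hl : l.length = w.length)
    (h : IsTreeState H S st c C)
    (hcard : ((H ++ walkSteps w c l).map Prod.fst).toFinset.card < (S ∪ l.toFinset).card)
    (hcount : ∀ e ∈ (H ++ walkSteps w c l).map Prod.fst,
      ((H ++ walkSteps w c l).map Prod.fst).count e = 2) :
    IsTreeWalk S st c w l := by
  induction w generalizing H S st c C l with
  | nil =>
    obtain rfl : l = [] := by simpa using hl
    exact isTreeWalk_nil_iff.2
      (h.stack_eq_nil_of_count_eq_two (by simpa [walkSteps] using hcount))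
  | cons b w ih =>
    rcases l with _ | ⟨j, l⟩
    · simp at hl
    have hl' : l.length = w.length := by simpa using hl
    have hstep : H ++ walkSteps (b :: w) c (j :: l) =
        (H ++ [(stepEdge b c j, b)]) ++ walkSteps w j l := by simp [walkSteps]
    rw [← insert_union_toFinset] at hcard
    by_cases hj : j ∈ S
    · rw [Finset.insert_eq_of_mem hj] at hcard
      have hold : stepEdge b c j ∈ H.map Prod.fst := h.stepEdge_mem_of_card_lt hl' hj hcard
      have hC : stepEdge b c j ∉ C := fun hC => by
        have htwo := hcount (stepEdge b c j) (by simp [walkSteps])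
        have := h.two_le_count_of_mem_closed hC
        simp only [walkSteps, List.map_append, List.map_cons, List.count_append,
          List.count_cons_self] at htwo
        lia
      have hstack := (List.mem_append.1 (h.mem_map_fst_iff.1 hold)).resolve_right hC
      obtain ⟨st', rfl⟩ := h.exists_stack_eq_cons hstack
      rw [hstep] at hcard hcount
      exact .pop hj (ih hl' h.pop hcard hcount)
    · rw [hstep] at hcard hcount
      exact .push hj (ih hl' (h.push b hj) hcard hcount)

theorem card_le_or_exists_count_ne_two {w : List Bool} {r : V} {l : List V}
    (hl : l.length = w.length) (h : ¬IsTreeWalk {r} [] r w l) :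
    ({r} ∪ l.toFinset).card ≤ ((walkSteps w r l).map Prod.fst).toFinset.card ∨
      ({r} ∪ l.toFinset).card ≤ ((walkSteps w r l).map Prod.fst).toFinset.card + 1 ∧
        ∃ e ∈ (walkSteps w r l).map Prod.fst, ((walkSteps w r l).map Prod.fst).count e ≠ 2 := by
  have hle := card_union_add_card_le hl (Finset.mem_singleton_self r)
    (E := ∅) (by simp)
  simp only [Finset.card_empty, Finset.empty_union, Finset.card_singleton] at hle
  by_contra! hcon
  exact h ((IsTreeState.init r).isTreeWalk hl hcon.1 (hcon.2 (by lia)))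

end Walks

/-! ### Weighted counts of walks -/

section WeightedCounts

/-- The weighted number of ways to read a word as a tree walk when `s` vertices have been visited
and a step to a new vertex carries the weight `1 - s * ε`, the proportion of new vertices among
`1 / ε` vertices. -/
def stackWeight (ε : ℝ) : List Bool → (s : ℕ) → List Bool → ℝ
  | [], _, st => if st = [] then 1 else 0
  | b :: w, s, st => (1 - s * ε) * stackWeight ε w (s + 1) (b :: st) +
      if st.head? = some (!b) then stackWeight ε w s st.tail else 0

theorem stackWeight_zero (w : List Bool) (s : ℕ) (st : List Bool) :
    stackWeight 0 w s st = stackCount w st := by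
  induction w generalizing s st with
  | nil => simp [stackWeight, stackCount]
  | cons b w ih => simp [stackWeight, stackCount, ih]

theorem continuous_stackWeight (w : List Bool) (s : ℕ) (st : List Bool) :
    Continuous fun ε => stackWeight ε w s st := by
  induction w generalizing s st with
  | nil => exact continuous_const
  | cons b w ih =>
    simp only [stackWeight]
    split_ifs <;> fun_prop

/-- Bound for the sum of `ε ^ (number of new vertices)` over all walks of length `n` from a state
in which `s` of the `1 / ε` vertices have been visited. -/
def walkBound : (n : ℕ) → (s : ℕ) → ℝ
  | 0, _ => 1
  | n + 1, s => s * walkBound n s + walkBound n (s + 1)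

theorem walkBound_nonneg (n s : ℕ) : 0 ≤ walkBound n s := by
  induction n generalizing s with
  | zero => exact zero_le_one
  | succ n ih => exact add_nonneg (mul_nonneg s.cast_nonneg (ih s)) (ih (s + 1))

variable {V : Type*} [Fintype V]

theorem sum_ofFn_succ {M : Type*} [AddCommMonoid M] (n : ℕ) (f : List V → M) :
    ∑ v : Fin (n + 1) → V, f (List.ofFn v) = ∑ j, ∑ v : Fin n → V, f (j :: List.ofFn v) := by
  rw [← (Fin.consEquiv fun _ => V).sum_comp, Fintype.sum_prod_type]
  simp [Fin.consEquiv, List.ofFn_succ]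

variable [DecidableEq V] {ε : ℝ}

theorem sum_pow_card_le (hε : 0 ≤ ε) (hV : Fintype.card V * ε ≤ 1) (n : ℕ) (S : Finset V) :
    ∑ v : Fin n → V, ε ^ (S ∪ (List.ofFn v).toFinset).card ≤ ε ^ S.card * walkBound n S.card := by
  induction n generalizing S with
  | zero => simp [walkBound]
  | succ n ih =>
    rw [sum_ofFn_succ n (fun l => ε ^ (S ∪ l.toFinset).card)]
    simp_rw [← insert_union_toFinset]
    rw [← Finset.sum_add_sum_compl S]
    have hold : ∑ j ∈ S, ∑ v : Fin n → V, ε ^ (insert j S ∪ (List.ofFn v).toFinset).card ≤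
        S.card * (ε ^ S.card * walkBound n S.card) := by
      rw [← nsmul_eq_mul]
      refine Finset.sum_le_card_nsmul _ _ _ fun j hj => ?_
      rw [Finset.insert_eq_of_mem hj]
      exact ih S
    have hnew : ∑ j ∈ Sᶜ, ∑ v : Fin n → V, ε ^ (insert j S ∪ (List.ofFn v).toFinset).card ≤
        Sᶜ.card * (ε ^ (S.card + 1) * walkBound n (S.card + 1)) := by
      rw [← nsmul_eq_mul]
      refine Finset.sum_le_card_nsmul _ _ _ fun j hj => ?_
      rw [← Finset.card_insert_of_notMem (Finset.mem_compl.1 hj)]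
      exact ih _
    have hcard : Sᶜ.card * ε ≤ 1 :=
      (mul_le_mul_of_nonneg_right (by exact_mod_cast Finset.card_le_univ _) hε).trans hV
    have hbound : 0 ≤ ε ^ S.card * walkBound n (S.card + 1) :=
      mul_nonneg (pow_nonneg hε _) (walkBound_nonneg _ _)
    rw [walkBound]
    linear_combination hold + hnew + mul_le_mul_of_nonneg_right hcard hbound

section SumIsTreeWalk

open scoped Classical in
/-- The sum of `ε ^ (number of visited vertices)` over all tree walks that continue a given state
along the word `w`. -/
noncomputable def treeWalkSum (ε : ℝ) (S : Finset V) (st : List (V × Bool)) (c : V)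
    (w : List Bool) : ℝ :=
  ∑ v : Fin w.length → V,
    if IsTreeWalk S st c w (List.ofFn v) then ε ^ (S ∪ (List.ofFn v).toFinset).card else 0

variable {S : Finset V} {st : List (V × Bool)} {c : V} {b : Bool} {w : List Bool}

theorem treeWalkSum_nil :
    treeWalkSum ε S st c [] = if st = [] then ε ^ S.card else 0 := by
  simp [treeWalkSum, isTreeWalk_nil_iff]

theorem treeWalkSum_cons :
    treeWalkSum ε S st c (b :: w) =
      ∑ j ∈ Sᶜ, treeWalkSum ε (insert j S) ((c, b) :: st) j w +
        ∑ j ∈ S, if st.head? = some (j, !b) then treeWalkSum ε S st.tail j w else 0 := by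
  classical
  rw [treeWalkSum, List.length_cons, sum_ofFn_succ w.length
    (fun l => if IsTreeWalk S st c (b :: w) l then ε ^ (S ∪ l.toFinset).card else 0),
    ← Finset.sum_compl_add_sum S]
  congr 1 <;> refine Finset.sum_congr rfl fun j hj => ?_
  · simp only [treeWalkSum, isTreeWalk_cons_iff_of_notMem (Finset.mem_compl.1 hj),
      ← insert_union_toFinset]
  · simp only [treeWalkSum, isTreeWalk_cons_iff_of_mem hj, ← insert_union_toFinset,
      Finset.insert_eq_of_mem hj, ite_and]
    split_ifs <;> simp

theorem treeWalkSum_eq (hV : Fintype.card V * ε = 1) (hst : ∀ v ∈ st.map Prod.fst, v ∈ S)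
    (hc : c ∈ S) :
    treeWalkSum ε S st c w = ε ^ S.card * stackWeight ε w S.card (st.map Prod.snd) := by
  induction w generalizing S st c with
  | nil => simp [treeWalkSum_nil, stackWeight]
  | cons b w ih =>
    have hpush : ∀ j ∈ Sᶜ, treeWalkSum ε (insert j S) ((c, b) :: st) j w =
        ε ^ (S.card + 1) * stackWeight ε w (S.card + 1) (b :: st.map Prod.snd) := by
      intro j hj
      rw [← Finset.card_insert_of_notMem (Finset.mem_compl.1 hj)]
      exact ih (List.forall_mem_cons.2 ⟨Finset.mem_insert_of_mem hc, fun v hv =>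
        Finset.mem_insert_of_mem (hst v hv)⟩) (Finset.mem_insert_self j S)
    have hpop : (∑ j ∈ S, if st.head? = some (j, !b) then treeWalkSum ε S st.tail j w else 0) =
        if (st.map Prod.snd).head? = some (!b) then
          ε ^ S.card * stackWeight ε w S.card (st.map Prod.snd).tail else 0 := by
      rcases st with _ | ⟨⟨p, a⟩, st⟩
      · simp
      · have hp : p ∈ S := hst p (by simp)
        have htail := ih (fun v hv => hst v (List.mem_cons_of_mem p hv)) hp
        by_cases ha : a = !b <;> simp [ha, hp, htail]
    have hnew : (Sᶜ.card : ℝ) = Fintype.card V - S.card := by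
      rw [Finset.card_compl, Nat.cast_sub (Finset.card_le_univ S)]
    rw [treeWalkSum_cons, Finset.sum_congr rfl hpush, hpop, Finset.sum_const, nsmul_eq_mul, hnew,
      stackWeight, mul_add, mul_ite, mul_zero]
    linear_combination (ε ^ S.card * stackWeight ε w (S.card + 1) (b :: st.map Prod.snd)) * hV

end SumIsTreeWalk

end WeightedCounts

/-! ### Path moments -/

section PathMoments

variable {V : Type*}

/-- A table of joint moments `q e a b` (standing for `E X_e ^ a * conj X_e ^ b`) of the entries of
a matrix whose entries have variance about `ε` and whose other moments are of smaller order. -/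
structure IsMomentTable (ε θ : ℝ) (q : V × V → ℕ → ℕ → ℂ) : Prop where
  zero : ∀ e, q e 0 0 = 1
  two : ∀ e a b, a + b = 2 → ‖q e a b‖ ≤ ε
  other : ∀ e a b, a + b ≠ 0 → a + b ≠ 2 → ‖q e a b‖ ≤ ε * θ
  variance : ∀ e, ‖q e 1 1 - ε‖ ≤ ε * θ

variable [DecidableEq V]

theorem count_map_fst (H : List ((V × V) × Bool)) (e : V × V) :
    (H.map Prod.fst).count e = H.count (e, true) + H.count (e, false) := by
  induction H with
  | nil => rfl
  | cons x H ih =>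
    obtain ⟨e', b⟩ := x
    simp only [List.map_cons, List.count_cons, ih]
    cases b <;> simp <;> lia

theorem count_eq_count_of_perm {H : List ((V × V) × Bool)} {C : List (V × V)}
    (hH : H.Perm (C.map (fun e => (e, true)) ++ C.map (fun e => (e, false)))) (e : V × V)
    (b : Bool) : H.count (e, b) = C.count e := by
  have hsame : ∀ b : Bool, (C.map fun e => (e, b)).count (e, b) = C.count e := fun b =>
    List.count_map_of_injective C _ (Prod.mk_left_injective b) e
  rw [hH.count_eq, List.count_append]
  cases b <;> simp [hsame, List.count_eq_zero]

variable [Fintype V]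

/-- The expectation of the product of the matrix entries along a walk, in terms of the joint
moments of the entries. -/
noncomputable def pathMoment (q : V × V → ℕ → ℕ → ℂ) (H : List ((V × V) × Bool)) : ℂ :=
  ∏ e, q e (H.count (e, true)) (H.count (e, false))

variable {ε θ : ℝ} {q : V × V → ℕ → ℕ → ℂ} {H : List ((V × V) × Bool)}

theorem IsMomentTable.pathMoment_eq_prod (hq : IsMomentTable ε θ q) :
    pathMoment q H =
      ∏ e ∈ (H.map Prod.fst).toFinset, q e (H.count (e, true)) (H.count (e, false)) := by
  refine (Finset.prod_subset (Finset.subset_univ _) fun e _ he => ?_).symm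
  rw [List.mem_toFinset, ← List.count_pos_iff, count_map_fst] at he
  rw [show H.count (e, true) = 0 by lia, show H.count (e, false) = 0 by lia, hq.zero]

theorem IsMomentTable.norm_pathMoment_le_prod (hq : IsMomentTable ε θ q) :
    ‖pathMoment q H‖ ≤ ∏ e ∈ (H.map Prod.fst).toFinset,
      ε * if (H.map Prod.fst).count e = 2 then 1 else θ := by
  rw [hq.pathMoment_eq_prod, norm_prod]
  refine Finset.prod_le_prod (fun _ _ => norm_nonneg _) fun e he => ?_
  rw [List.mem_toFinset, ← List.count_pos_iff] at he
  rw [count_map_fst] at he ⊢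
  split_ifs with htwo
  · rw [mul_one]
    exact hq.two e _ _ htwo
  · exact hq.other e _ _ he.ne' htwo

theorem IsMomentTable.norm_pathMoment_le (hq : IsMomentTable ε θ q) (hε : 0 ≤ ε) (hθ : 0 ≤ θ)
    (hθ1 : θ ≤ 1) : ‖pathMoment q H‖ ≤ ε ^ (H.map Prod.fst).toFinset.card := by
  refine hq.norm_pathMoment_le_prod.trans ?_
  rw [Finset.prod_mul_distrib, Finset.prod_const]
  refine mul_le_of_le_one_right (pow_nonneg hε _)
    (Finset.prod_le_one (fun _ _ => ?_) fun _ _ => ?_) <;> split_ifs <;> simp [hθ, hθ1]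

theorem IsMomentTable.norm_pathMoment_le_mul (hq : IsMomentTable ε θ q) (hε : 0 ≤ ε)
    (hθ : 0 ≤ θ) (hθ1 : θ ≤ 1) (hH : ∃ e ∈ H.map Prod.fst, (H.map Prod.fst).count e ≠ 2) :
    ‖pathMoment q H‖ ≤ θ * ε ^ (H.map Prod.fst).toFinset.card := by
  obtain ⟨e₀, he₀, hcount⟩ := hH
  refine hq.norm_pathMoment_le_prod.trans ?_
  rw [Finset.prod_mul_distrib, Finset.prod_const, mul_comm,
    ← Finset.mul_prod_erase _ _ (List.mem_toFinset.2 he₀), if_neg hcount]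
  refine mul_le_mul_of_nonneg_right (mul_le_of_le_one_right hθ
    (Finset.prod_le_one (fun _ _ => ?_) fun _ _ => ?_)) (pow_nonneg hε _) <;>
      split_ifs <;> simp [hθ, hθ1]

theorem IsMomentTable.pathMoment_of_perm (hq : IsMomentTable ε θ q) {C : List (V × V)}
    (hC : C.Nodup) (hH : H.Perm (C.map (fun e => (e, true)) ++ C.map (fun e => (e, false)))) :
    pathMoment q H = ∏ e ∈ C.toFinset, q e 1 1 := by
  have hset : (H.map Prod.fst).toFinset = C.toFinset := by
    ext e
    simp only [List.mem_toFinset, (hH.map Prod.fst).mem_iff]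
    simp [Function.comp_def]
  rw [hq.pathMoment_eq_prod, hset]
  refine Finset.prod_congr rfl fun e he => ?_
  rw [count_eq_count_of_perm hH, count_eq_count_of_perm hH,
    List.count_eq_one_of_mem hC (List.mem_toFinset.1 he)]

theorem norm_prod_sub_pow_card_le {ι 𝕜 : Type*} [NormedField 𝕜] {s : Finset ι} {z : ι → 𝕜}
    {x : 𝕜} {δ : ℝ} (hz : ∀ i ∈ s, ‖z i‖ ≤ ‖x‖) (hzx : ∀ i ∈ s, ‖z i - x‖ ≤ ‖x‖ * δ) :
    ‖∏ i ∈ s, z i - x ^ s.card‖ ≤ s.card * δ * ‖x‖ ^ s.card := by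
  induction s using Finset.cons_induction with
  | empty => simp
  | cons i s hi ih =>
    rw [Finset.forall_mem_cons] at hz hzx
    rw [Finset.prod_cons, Finset.card_cons, pow_succ',
      show z i * ∏ j ∈ s, z j - x * x ^ s.card =
        z i * (∏ j ∈ s, z j - x ^ s.card) + (z i - x) * x ^ s.card by ring]
    refine (norm_add_le _ _).trans ?_
    rw [norm_mul, norm_mul, norm_pow]
    calc ‖z i‖ * ‖∏ j ∈ s, z j - x ^ s.card‖ + ‖z i - x‖ * ‖x‖ ^ s.card
        ≤ ‖x‖ * (s.card * δ * ‖x‖ ^ s.card) + ‖x‖ * δ * ‖x‖ ^ s.card := by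
          gcongr
          exacts [hz.1, ih hz.2 hzx.2, hzx.1]
      _ = (s.card + 1 : ℕ) * δ * ‖x‖ ^ (s.card + 1) := by push_cast; ring

variable {w : List Bool} {r : V} {l : List V}

theorem IsTreeWalk.norm_mul_pathMoment_sub_le (h : IsTreeWalk {r} [] r w l)
    (hq : IsMomentTable ε θ q) (hε : 0 ≤ ε) :
    ‖ε * pathMoment q (walkSteps w r l) - (ε : ℂ) ^ ({r} ∪ l.toFinset).card‖ ≤
      l.length * θ * ε ^ ({r} ∪ l.toFinset).card := by
  obtain ⟨-, C, hC, hcard, hperm⟩ := h.exists_perm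
  have hnorm : ‖(ε : ℂ)‖ = ε := by rw [Complex.norm_real, Real.norm_of_nonneg hε]
  have hprod : ‖∏ e ∈ C.toFinset, q e 1 1 - (ε : ℂ) ^ C.length‖ ≤
      C.length * θ * ε ^ C.length := by
    rw [← List.toFinset_card_of_nodup hC]
    simpa only [hnorm] using norm_prod_sub_pow_card_le (s := C.toFinset) (x := (ε : ℂ))
      (fun e _ => (hq.two e 1 1 rfl).trans_eq hnorm.symm)
      (fun e _ => (hq.variance e).trans_eq (by rw [hnorm]))
  have hle : C.length ≤ l.length := by
    have := Finset.card_union_le {r} l.toFinset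
    have := l.toFinset_card_le
    rw [Finset.card_singleton] at *
    lia
  have hθ : 0 ≤ ε * θ := (norm_nonneg _).trans (hq.variance (r, r))
  rw [hq.pathMoment_of_perm hC hperm, ← hcard, pow_succ', ← mul_sub, norm_mul, hnorm]
  calc ε * ‖∏ e ∈ C.toFinset, q e 1 1 - (ε : ℂ) ^ C.length‖
      ≤ ε * (C.length * θ * ε ^ C.length) := by gcongr
    _ = C.length * (ε * θ) * ε ^ C.length := by ring
    _ ≤ l.length * (ε * θ) * ε ^ C.length := by gcongr
    _ = l.length * θ * ε ^ (C.length + 1) := by ring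

theorem norm_mul_pathMoment_le_of_not_isTreeWalk (h : ¬IsTreeWalk {r} [] r w l)
    (hl : l.length = w.length) (hq : IsMomentTable ε θ q) (hε : 0 ≤ ε) (hε1 : ε ≤ 1)
    (hθ : 0 ≤ θ) (hθ1 : θ ≤ 1) :
    ‖ε * pathMoment q (walkSteps w r l)‖ ≤ (θ + ε) * ε ^ ({r} ∪ l.toFinset).card := by
  set n := ({r} ∪ l.toFinset).card
  set k := ((walkSteps w r l).map Prod.fst).toFinset.card
  have : 0 ≤ ε ^ n := pow_nonneg hε n
  rw [norm_mul, Complex.norm_real, Real.norm_of_nonneg hε]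
  rcases card_le_or_exists_count_ne_two hl h with hcard | ⟨hcard, hcount⟩
  · calc ε * ‖pathMoment q (walkSteps w r l)‖
        ≤ ε * ε ^ k := by gcongr; exact hq.norm_pathMoment_le hε hθ hθ1
      _ ≤ ε * ε ^ n := by gcongr ε * ?_; exact pow_le_pow_of_le_one hε hε1 hcard
      _ ≤ (θ + ε) * ε ^ n := by gcongr; linarith
  · calc ε * ‖pathMoment q (walkSteps w r l)‖
        ≤ ε * (θ * ε ^ k) := by gcongr; exact hq.norm_pathMoment_le_mul hε hθ hθ1 hcount
      _ = θ * ε ^ (k + 1) := by ring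
      _ ≤ θ * ε ^ n := by gcongr θ * ?_; exact pow_le_pow_of_le_one hε hε1 hcard
      _ ≤ (θ + ε) * ε ^ n := by gcongr; linarith

open scoped Classical in
theorem norm_mul_ite_pathMoment_sub_ite_le (hl : l.length = w.length) (hq : IsMomentTable ε θ q)
    (hε : 0 ≤ ε) (hε1 : ε ≤ 1) (hθ : 0 ≤ θ) (hθ1 : θ ≤ 1) :
    ‖ε * (if l.getLastD r = r then pathMoment q (walkSteps w r l) else 0) -
        if IsTreeWalk {r} [] r w l then (ε : ℂ) ^ ({r} ∪ l.toFinset).card else 0‖ ≤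
      ((w.length + 1) * θ + ε) * ε ^ ({r} ∪ l.toFinset).card := by
  have : (0 : ℝ) ≤ w.length := Nat.cast_nonneg _
  by_cases hw : IsTreeWalk {r} [] r w l
  · rw [if_pos hw, if_pos hw.exists_perm.1]
    refine (hw.norm_mul_pathMoment_sub_le hq hε).trans ?_
    rw [hl]
    gcongr
    linarith
  · rw [if_neg hw, sub_zero]
    split_ifs
    · refine (norm_mul_pathMoment_le_of_not_isTreeWalk hw hl hq hε hε1 hθ hθ1).trans ?_
      gcongr
      exact le_mul_of_one_le_left hθ (by linarith)
    · rw [mul_zero, norm_zero]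
      positivity

/-- The sum of the path moments over all closed walks along a word: the expectation of the trace
of the word in the matrix and its adjoint. -/
noncomputable def closedWalkSum (q : V × V → ℕ → ℕ → ℂ) (w : List Bool) : ℂ :=
  ∑ r : V, ∑ v : Fin w.length → V,
    if (List.ofFn v).getLastD r = r then pathMoment q (walkSteps w r (List.ofFn v)) else 0

theorem stackWeight_eq_sum_treeWalkSum (hV : Fintype.card V * ε = 1) :
    stackWeight ε w 1 [] = ∑ r : V, treeWalkSum ε {r} [] r w := by
  have htree : ∀ r : V, treeWalkSum ε {r} [] r w = ε * stackWeight ε w 1 [] := fun r => by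
    simpa using treeWalkSum_eq (w := w) hV (S := {r}) (st := []) (by simp) (by simp)
  simp_rw [htree, Finset.sum_const, Finset.card_univ, nsmul_eq_mul]
  rw [← mul_assoc, hV, one_mul]

theorem IsMomentTable.norm_closedWalkSum_sub_le (hq : IsMomentTable ε θ q)
    (hV : Fintype.card V * ε = 1) (hθ : 0 ≤ θ) (hθ1 : θ ≤ 1) (w : List Bool) :
    ‖ε * closedWalkSum q w - stackWeight ε w 1 []‖ ≤
      ((w.length + 1) * θ + ε) * walkBound w.length 1 := by
  classical
  have hcard : (1 : ℝ) ≤ Fintype.card V := by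
    rw [Nat.one_le_cast, Nat.one_le_iff_ne_zero]
    intro h
    simp [h] at hV
  have hε : 0 ≤ ε := (pos_of_mul_pos_right (hV.trans_gt one_pos) (by linarith)).le
  have hε1 : ε ≤ 1 := (le_mul_of_one_le_left hε hcard).trans_eq hV
  set K := (w.length + 1) * θ + ε
  rw [stackWeight_eq_sum_treeWalkSum hV]
  simp only [closedWalkSum, treeWalkSum, Complex.ofReal_sum, apply_ite Complex.ofReal,
    Complex.ofReal_pow, Complex.ofReal_zero]
  rw [Finset.mul_sum, ← Finset.sum_sub_distrib]
  simp_rw [Finset.mul_sum, ← Finset.sum_sub_distrib]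
  calc _ ≤ ∑ r : V, ∑ v : Fin w.length → V, K * ε ^ ({r} ∪ (List.ofFn v).toFinset).card :=
        (norm_sum_le _ _).trans (Finset.sum_le_sum fun r _ => norm_sum_le_of_le _ fun v _ =>
          norm_mul_ite_pathMoment_sub_ite_le (by simp) hq hε hε1 hθ hθ1)
    _ = ∑ r : V, K * ∑ v : Fin w.length → V, ε ^ ({r} ∪ (List.ofFn v).toFinset).card := by
        simp_rw [Finset.mul_sum]
    _ ≤ ∑ r : V, K * (ε ^ ({r} : Finset V).card * walkBound w.length ({r} : Finset V).card) := by
        gcongr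
        exact sum_pow_card_le hε hV.le w.length {_}
    _ = K * walkBound w.length 1 := by
        simp only [Finset.card_singleton, pow_one, Finset.sum_const, Finset.card_univ,
          nsmul_eq_mul]
        linear_combination K * walkBound w.length 1 * hV

end PathMoments

/-! ### Traces of words in a random matrix and its adjoint -/

section WordMatrix

variable {V R : Type*} [Fintype V] [DecidableEq V]

section Semiring

variable [Semiring R] [StarRing R]

/-- The product of copies of `X` and of its adjoint prescribed by a word. -/
def wordMatrix (X : Matrix V V R) (w : List Bool) : Matrix V V R :=
  (w.map fun b => if b then X else X.conjTranspose).prod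

/-- The factor contributed by a step of a walk to an entry of a product of matrices. -/
def stepFactor (X : Matrix V V R) (s : (V × V) × Bool) : R :=
  if s.2 then X s.1.1 s.1.2 else star (X s.1.1 s.1.2)

theorem wordMatrix_cons (X : Matrix V V R) (b : Bool) (w : List Bool) :
    wordMatrix X (b :: w) = (if b then X else X.conjTranspose) * wordMatrix X w := by
  simp [wordMatrix]

theorem wordMatrix_append (X : Matrix V V R) (w w' : List Bool) :
    wordMatrix X (w ++ w') = wordMatrix X w * wordMatrix X w' := by
  simp [wordMatrix]

theorem wordMatrix_replicate (X : Matrix V V R) (n : ℕ) (b : Bool) :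
    wordMatrix X (List.replicate n b) = (if b then X else X.conjTranspose) ^ n := by
  simp [wordMatrix]

theorem wordMatrix_apply (X : Matrix V V R) (w : List Bool) (r s : V) :
    wordMatrix X w r s = ∑ v : Fin w.length → V, if (List.ofFn v).getLastD r = s then
      ((walkSteps w r (List.ofFn v)).map (stepFactor X)).prod else 0 := by
  induction w generalizing r with
  | nil => simp [wordMatrix, walkSteps, Matrix.one_apply]
  | cons b w ih =>
    have hstep : ∀ j, (if b then X else X.conjTranspose) r j =
        stepFactor X (stepEdge b r j, b) := by
      intro j
      cases b <;> simp [stepFactor, stepEdge, Matrix.conjTranspose_apply]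
    rw [List.length_cons, sum_ofFn_succ w.length (fun l => if l.getLastD r = s then
      ((walkSteps (b :: w) r l).map (stepFactor X)).prod else 0), wordMatrix_cons,
      Matrix.mul_apply]
    refine Finset.sum_congr rfl fun j _ => ?_
    rw [hstep, ih, Finset.mul_sum]
    refine Finset.sum_congr rfl fun v _ => ?_
    rw [List.getLastD_cons, walkSteps, List.map_cons, List.prod_cons, mul_ite, mul_zero]

end Semiring

theorem prod_map_stepFactor [CommSemiring R] [StarRing R] (X : Matrix V V R)
    (H : List ((V × V) × Bool)) :
    (H.map (stepFactor X)).prod = ∏ e : V × V,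
      X e.1 e.2 ^ H.count (e, true) * star (X e.1 e.2) ^ H.count (e, false) := by
  have hpow (s : (V × V) × Bool) (hs : s ∉ H.toFinset) : stepFactor X s ^ H.count s = 1 := by
    rw [List.count_eq_zero.2 (by simpa using hs), pow_zero]
  calc (H.map (stepFactor X)).prod
      = ∏ s ∈ H.toFinset, stepFactor X s ^ H.count s := by
        rw [Finset.prod_list_map_count]
        congr!
    _ = ∏ s, stepFactor X s ^ H.count s :=
        Finset.prod_subset (Finset.subset_univ _) fun s _ => hpow s
    _ = _ := by simp [Fintype.prod_prod_type, stepFactor]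

variable {Ω : Type*} [MeasurableSpace Ω] {μ : Measure Ω}

/-- The joint moments of the entries of a random matrix and of their conjugates. -/
noncomputable def entryMoment (μ : Measure Ω) (X : Ω → Matrix V V ℂ) (e : V × V) (a b : ℕ) : ℂ :=
  ∫ ω, X ω e.1 e.2 ^ a * star (X ω e.1 e.2) ^ b ∂μ

theorem integrable_prod_map_stepFactor {ι : Type*} [IsFiniteMeasure μ] {Y : Ω → Matrix ι ι ℂ}
    {M : ℝ} (hY : ∀ i j, Measurable fun ω => Y ω i j) (hM : ∀ i j ω, ‖Y ω i j‖ ≤ M)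
    (H : List ((ι × ι) × Bool)) : Integrable (fun ω => (H.map (stepFactor (Y ω))).prod) μ := by
  induction H with
  | nil => exact integrable_const 1
  | cons s H ih =>
    have hmeas : Measurable fun ω => stepFactor (Y ω) s := by
      unfold stepFactor
      have := hY s.1.1 s.1.2
      split_ifs <;> fun_prop
    have hbound : ∀ ω, ‖stepFactor (Y ω) s‖ ≤ M := fun ω => by
      unfold stepFactor
      split_ifs
      · exact hM _ _ ω
      · exact (norm_star _).trans_le (hM _ _ ω)
    simp only [List.map_cons, List.prod_cons]
    exact ih.bdd_mul hmeas.aestronglyMeasurable (Eventually.of_forall hbound)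

variable {X : Ω → Matrix V V ℂ} {M : ℝ}

theorem integral_prod_pow_mul_star_pow (hX : ∀ i j, Measurable fun ω => X ω i j)
    (hind : iIndepFun (fun (e : V × V) ω => X ω e.1 e.2) μ) (H : List ((V × V) × Bool)) :
    ∫ ω, ∏ e : V × V, X ω e.1 e.2 ^ H.count (e, true) * star (X ω e.1 e.2) ^ H.count (e, false) ∂μ =
      pathMoment (entryMoment μ X) H :=
  hind.integral_fun_prod_comp
    (f := fun e z => z ^ H.count (e, true) * star z ^ H.count (e, false))
    (fun e => (hX _ _).aemeasurable)
    (fun e => Continuous.aestronglyMeasurable (by fun_prop))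

theorem integrable_wordMatrix_apply [IsFiniteMeasure μ]
    (hX : ∀ i j, Measurable fun ω => X ω i j) (hM : ∀ i j ω, ‖X ω i j‖ ≤ M) (w : List Bool)
    (i j : V) : Integrable (fun ω => wordMatrix (X ω) w i j) μ := by
  simp only [wordMatrix_apply]
  refine integrable_finsetSum _ fun v _ => ?_
  split_ifs
  · exact integrable_prod_map_stepFactor hX hM _
  · exact integrable_zero _ _ _

theorem integrable_trace_wordMatrix [IsFiniteMeasure μ]
    (hX : ∀ i j, Measurable fun ω => X ω i j) (hM : ∀ i j ω, ‖X ω i j‖ ≤ M) (w : List Bool) :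
    Integrable (fun ω => (wordMatrix (X ω) w).trace) μ :=
  integrable_finsetSum _ fun r _ => integrable_wordMatrix_apply hX hM w r r

theorem integral_trace_wordMatrix [IsFiniteMeasure μ]
    (hX : ∀ i j, Measurable fun ω => X ω i j) (hM : ∀ i j ω, ‖X ω i j‖ ≤ M)
    (hind : iIndepFun (fun (e : V × V) ω => X ω e.1 e.2) μ) (w : List Bool) :
    ∫ ω, (wordMatrix (X ω) w).trace ∂μ = closedWalkSum (entryMoment μ X) w := by
  simp only [Matrix.trace, Matrix.diag_apply, closedWalkSum]
  rw [integral_finsetSum _ fun r _ => integrable_wordMatrix_apply hX hM w r r]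
  refine Finset.sum_congr rfl fun r _ => ?_
  simp only [wordMatrix_apply]
  rw [integral_finsetSum _ fun v _ => ?_]
  · refine Finset.sum_congr rfl fun v _ => ?_
    split_ifs
    · simp only [prod_map_stepFactor]
      exact integral_prod_pow_mul_star_pow hX hind _
    · exact integral_zero _ _
  · split_ifs
    · exact integrable_prod_map_stepFactor hX hM _
    · exact integrable_zero _ _ _

end WordMatrix

theorem powerMatrix_pow_eq {N : ℕ} (m p : ℕ) (X : Matrix (Fin N) (Fin N) ℂ) :
    powerMatrix m X ^ p = wordMatrix X (blockWord m p) := by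
  induction p with
  | zero => simp [blockWord, wordMatrix]
  | succ p ih =>
    rw [pow_succ', ih, blockWord_succ]
    simp [wordMatrix_append, wordMatrix_replicate, powerMatrix, mul_assoc]

theorem sum_eigenvalues_pow {n 𝕜 : Type*} [RCLike 𝕜] [Fintype n] [DecidableEq n]
    {A : Matrix n n 𝕜} (hA : A.IsHermitian) (p : ℕ) :
    ∑ k, (hA.eigenvalues k : 𝕜) ^ p = (A ^ p).trace := by
  conv_rhs => rw [hA.spectral_theorem]
  rw [← map_pow, Unitary.conjStarAlgAut_apply, Matrix.trace_mul_cycle]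
  simp [Matrix.diagonal_pow, Matrix.trace_diagonal]

/-! ### Truncation -/

section Truncation

variable {E : Type*} [NormedAddCommGroup E]

/-- Truncation of a vector at level `c`: vectors of norm larger than `c` are replaced by `0`. -/
noncomputable def truncate (c : ℝ) (z : E) : E := if ‖z‖ ≤ c then z else 0

theorem measurable_truncate [MeasurableSpace E] [OpensMeasurableSpace E] (c : ℝ) :
    Measurable (truncate c : E → E) :=
  Measurable.ite (measurableSet_le measurable_norm measurable_const) measurable_id measurable_const

theorem norm_truncate_le_norm (c : ℝ) (z : E) : ‖truncate c z‖ ≤ ‖z‖ := by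
  unfold truncate
  split_ifs <;> simp

theorem norm_truncate_le {c : ℝ} (hc : 0 ≤ c) (z : E) : ‖truncate c z‖ ≤ c := by
  unfold truncate
  split_ifs with h
  · exact h
  · simpa using hc

theorem norm_sub_truncate_mul_pow_le {c : ℝ} (hc : 0 ≤ c) (z : E) (n : ℕ) :
    ‖z - truncate c z‖ * c ^ n ≤ ‖z‖ ^ (n + 1) := by
  unfold truncate
  split_ifs with h
  · simp only [sub_self, norm_zero, zero_mul]
    positivity
  · rw [sub_zero, pow_succ']
    gcongr
    exact (not_le.1 h).le

theorem norm_pow_sub_norm_truncate_pow_mul_pow_le {c : ℝ} (hc : 0 ≤ c) (z : E) {k : ℕ}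
    (hk : k ≠ 0) (n : ℕ) : (‖z‖ ^ k - ‖truncate c z‖ ^ k) * c ^ n ≤ ‖z‖ ^ (k + n) := by
  unfold truncate
  split_ifs with h
  · simp only [sub_self, zero_mul]
    positivity
  · rw [norm_zero, zero_pow hk, sub_zero, pow_add]
    gcongr
    exact (not_le.1 h).le

variable {Ω : Type*} [MeasurableSpace Ω] {μ : Measure Ω} {f : Ω → E} {c : ℝ} {n : ℕ}

theorem integrable_norm_truncate_pow [MeasurableSpace E] [OpensMeasurableSpace E]
    (hf : Measurable f) (hint : Integrable (fun ω => ‖f ω‖ ^ n) μ) :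
    Integrable (fun ω => ‖truncate c (f ω)‖ ^ n) μ := by
  refine hint.mono' (((measurable_truncate c).comp hf).norm.pow_const n).aestronglyMeasurable
    (Eventually.of_forall fun ω => ?_)
  rw [norm_pow, norm_norm]
  gcongr
  exact norm_truncate_le_norm c _

theorem integral_norm_truncate_pow_le (hint : Integrable (fun ω => ‖f ω‖ ^ n) μ) :
    ∫ ω, ‖truncate c (f ω)‖ ^ n ∂μ ≤ ∫ ω, ‖f ω‖ ^ n ∂μ :=
  integral_mono_of_nonneg (Eventually.of_forall fun ω => by positivity) hint
    (Eventually.of_forall fun ω => by dsimp only; gcongr; exact norm_truncate_le_norm c _)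

theorem integral_norm_pow_sub_integral_norm_truncate_pow_mul_pow_le [MeasurableSpace E]
    [OpensMeasurableSpace E] (hf : Measurable f) (hc : 0 ≤ c) {k : ℕ} (hk : k ≠ 0)
    (hintk : Integrable (fun ω => ‖f ω‖ ^ k) μ)
    (hint : Integrable (fun ω => ‖f ω‖ ^ (k + n)) μ) :
    (∫ ω, ‖f ω‖ ^ k ∂μ - ∫ ω, ‖truncate c (f ω)‖ ^ k ∂μ) * c ^ n ≤ ∫ ω, ‖f ω‖ ^ (k + n) ∂μ := by
  have hintt := integrable_norm_truncate_pow (c := c) hf hintk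
  rw [← integral_sub hintk hintt, ← integral_mul_const]
  exact integral_mono ((hintk.sub hintt).mul_const _) hint fun ω =>
    norm_pow_sub_norm_truncate_pow_mul_pow_le hc (f ω) hk n

theorem norm_integral_truncate_mul_pow_le [NormedSpace ℝ E] [MeasurableSpace E] [BorelSpace E]
    [SecondCountableTopology E] (hf : Measurable f) (hc : 0 ≤ c) (hintf : Integrable f μ)
    (hmean : ∫ ω, f ω ∂μ = 0) (hint : Integrable (fun ω => ‖f ω‖ ^ (n + 1)) μ) :
    ‖∫ ω, truncate c (f ω) ∂μ‖ * c ^ n ≤ ∫ ω, ‖f ω‖ ^ (n + 1) ∂μ := by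
  have hintt : Integrable (fun ω => truncate c (f ω)) μ :=
    hintf.mono ((measurable_truncate c).comp hf).aestronglyMeasurable
      (Eventually.of_forall fun ω => norm_truncate_le_norm c _)
  calc ‖∫ ω, truncate c (f ω) ∂μ‖ * c ^ n
      = ‖∫ ω, (f ω - truncate c (f ω)) ∂μ‖ * c ^ n := by
        rw [integral_sub hintf hintt, hmean, zero_sub, norm_neg]
    _ ≤ (∫ ω, ‖f ω - truncate c (f ω)‖ ∂μ) * c ^ n := by
        gcongr
        exact norm_integral_le_integral_norm _
    _ ≤ ∫ ω, ‖f ω‖ ^ (n + 1) ∂μ := by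
        rw [← integral_mul_const]
        exact integral_mono ((hintf.sub hintt).norm.mul_const _) hint fun ω =>
          norm_sub_truncate_mul_pow_le hc (f ω) n

end Truncation

section JointMoments

variable {Ω : Type*} [MeasurableSpace Ω] {μ : Measure Ω}

theorem norm_integral_pow_mul_star_pow_le {𝕜 : Type*} [RCLike 𝕜] {f : Ω → 𝕜} {c : ℝ}
    (hc : ∀ ω, ‖f ω‖ ≤ c) (hint : Integrable (fun ω => ‖f ω‖ ^ 2) μ) {a b k : ℕ}
    (hk : a + b = k + 2) :
    ‖∫ ω, f ω ^ a * star (f ω) ^ b ∂μ‖ ≤ c ^ k * ∫ ω, ‖f ω‖ ^ 2 ∂μ := by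
  rw [← integral_const_mul]
  refine norm_integral_le_of_norm_le (hint.const_mul _) (Eventually.of_forall fun ω => ?_)
  rw [norm_mul, norm_pow, norm_pow, norm_star, ← pow_add, hk, pow_add]
  gcongr
  exact hc ω

theorem integral_const_mul_pow_mul_star_pow (r : ℝ) (f : Ω → ℂ) (a b : ℕ) :
    ∫ ω, (r * f ω) ^ a * star (r * f ω) ^ b ∂μ =
      (r : ℂ) ^ (a + b) * ∫ ω, f ω ^ a * star (f ω) ^ b ∂μ := by
  rw [← integral_const_mul]
  congr with ω
  simp only [star_mul', RCLike.star_def, Complex.conj_ofReal]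
  ring

end JointMoments

section TruncatedMoments

variable {Ω : Type*} [MeasurableSpace Ω] {μ : Measure Ω}

/-- A complex random variable with mean `0`, variance `1` and fourth moment at most `B`. -/
structure IsStandardized (f : Ω → ℂ) (μ : Measure Ω) (B : ℝ) : Prop where
  measurable : Measurable f
  mean : ∫ ω, f ω ∂μ = 0
  variance : ∫ ω, ‖f ω‖ ^ 2 ∂μ = 1
  integrable_fourth : Integrable (fun ω => ‖f ω‖ ^ 4) μ
  fourth_le : ∫ ω, ‖f ω‖ ^ 4 ∂μ ≤ B

namespace IsStandardized

variable {f : Ω → ℂ} {B r α : ℝ}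

theorem integrable_sq (hf : IsStandardized f μ B) : Integrable (fun ω => ‖f ω‖ ^ 2) μ :=
  Integrable.of_integral_ne_zero (hf.variance.trans_ne one_ne_zero)

theorem integrable [IsFiniteMeasure μ] (hf : IsStandardized f μ B) : Integrable f μ :=
  ((memLp_two_iff_integrable_sq_norm hf.measurable.aestronglyMeasurable).2
    hf.integrable_sq).integrable one_le_two

theorem bound_nonneg (hf : IsStandardized f μ B) : 0 ≤ B :=
  (integral_nonneg fun ω => by positivity).trans hf.fourth_le

theorem integral_norm_truncate_sq_le (hf : IsStandardized f μ B) (c : ℝ) :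
    ∫ ω, ‖truncate c (f ω)‖ ^ 2 ∂μ ≤ 1 :=
  (integral_norm_truncate_pow_le hf.integrable_sq).trans_eq hf.variance

theorem norm_jointMoment_truncate_le (hf : IsStandardized f μ B) (hr : 0 < r) (hα : 0 ≤ α)
    {a b k : ℕ} (hk : a + b = k + 2) :
    ‖∫ ω, (r * truncate (α / r) (f ω)) ^ a * star (r * truncate (α / r) (f ω)) ^ b ∂μ‖ ≤
      r ^ 2 * α ^ k := by
  have hmoment := norm_integral_pow_mul_star_pow_le (μ := μ)
    (fun ω => norm_truncate_le (div_nonneg hα hr.le) (f ω))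
    (integrable_norm_truncate_pow hf.measurable hf.integrable_sq) hk
  have hle := hf.integral_norm_truncate_sq_le (α / r)
  rw [integral_const_mul_pow_mul_star_pow, norm_mul, norm_pow, Complex.norm_of_nonneg hr.le, hk]
  calc r ^ (k + 2) * ‖∫ ω, truncate (α / r) (f ω) ^ a * star (truncate (α / r) (f ω)) ^ b ∂μ‖
      ≤ r ^ (k + 2) * ((α / r) ^ k * 1) := by
        gcongr
        exact hmoment.trans (by gcongr)
    _ = r ^ 2 * α ^ k := by
        rw [mul_one, pow_add, mul_right_comm, ← mul_pow, mul_div_cancel₀ α hr.ne', mul_comm]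

theorem norm_mean_truncate_le [IsFiniteMeasure μ] (hf : IsStandardized f μ B) (hr : 0 < r)
    (hα : 0 < α) : ‖∫ ω, r * truncate (α / r) (f ω) ∂μ‖ ≤ r ^ 2 * (r ^ 2 * B / α ^ 3) := by
  have hmean : ‖∫ ω, truncate (α / r) (f ω) ∂μ‖ * (α / r) ^ 3 ≤ B :=
    (norm_integral_truncate_mul_pow_le hf.measurable (div_nonneg hα.le hr.le) hf.integrable
      hf.mean hf.integrable_fourth).trans hf.fourth_le
  rw [integral_const_mul, norm_mul, Complex.norm_of_nonneg hr.le]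
  calc r * ‖∫ ω, truncate (α / r) (f ω) ∂μ‖
      ≤ r * (B / (α / r) ^ 3) := by
        gcongr
        rwa [le_div_iff₀ (by positivity)]
    _ = r ^ 2 * (r ^ 2 * B / α ^ 3) := by field_simp

theorem norm_jointMoment_truncate_of_add_eq_one_le [IsFiniteMeasure μ] (hf : IsStandardized f μ B)
    (hr : 0 < r) (hα : 0 < α) {a b : ℕ} (hab : a + b = 1) :
    ‖∫ ω, (r * truncate (α / r) (f ω)) ^ a * star (r * truncate (α / r) (f ω)) ^ b ∂μ‖ ≤
      r ^ 2 * (r ^ 2 * B / α ^ 3) := by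
  refine le_of_eq_of_le ?_ (hf.norm_mean_truncate_le hr hα)
  obtain ⟨rfl, rfl⟩ | ⟨rfl, rfl⟩ : (a = 1 ∧ b = 0) ∨ (a = 0 ∧ b = 1) := by lia
  · simp only [pow_one, pow_zero, mul_one]
  · simp only [pow_one, pow_zero, one_mul, RCLike.star_def]
    rw [integral_conj, RCLike.norm_conj]

theorem norm_variance_truncate_sub_le (hf : IsStandardized f μ B) (hr : 0 < r) (hα : 0 < α) :
    ‖∫ ω, (r * truncate (α / r) (f ω)) ^ 1 * star (r * truncate (α / r) (f ω)) ^ 1 ∂μ -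
      (r ^ 2 : ℝ)‖ ≤ r ^ 2 * (r ^ 2 * B / α ^ 2) := by
  set V := ∫ ω, ‖truncate (α / r) (f ω)‖ ^ 2 ∂μ with hV
  have hdefect : (1 - V) * (α / r) ^ 2 ≤ B := by
    rw [hV, ← hf.variance]
    exact (integral_norm_pow_sub_integral_norm_truncate_pow_mul_pow_le hf.measurable
      (div_nonneg hα.le hr.le) two_ne_zero hf.integrable_sq hf.integrable_fourth).trans hf.fourth_le
  have hmoment : ∫ ω, truncate (α / r) (f ω) ^ 1 * star (truncate (α / r) (f ω)) ^ 1 ∂μ = V := by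
    rw [hV, ← integral_complex_ofReal]
    congr with ω
    simp only [pow_one, RCLike.star_def, Complex.mul_conj']
    push_cast
    rfl
  have hV1 : V ≤ 1 := hf.integral_norm_truncate_sq_le _
  rw [integral_const_mul_pow_mul_star_pow, hmoment]
  calc ‖(r : ℂ) ^ (1 + 1) * V - (r ^ 2 : ℝ)‖ = ‖((r ^ 2 * (V - 1) : ℝ) : ℂ)‖ := by
        congr 1
        push_cast
        ring
    _ = r ^ 2 * (1 - V) := by
        rw [Complex.norm_real, norm_mul, Real.norm_of_nonneg (sq_nonneg r), Real.norm_eq_abs,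
          abs_sub_comm, abs_of_nonneg (sub_nonneg.2 hV1)]
    _ ≤ r ^ 2 * (B / (α / r) ^ 2) := by
        gcongr
        rwa [le_div_iff₀ (by positivity)]
    _ = r ^ 2 * (r ^ 2 * B / α ^ 2) := by field_simp

theorem isMomentTable_entryMoment {V : Type*} [IsProbabilityMeasure μ] {x : V → V → Ω → ℂ}
    (hx : ∀ i j, IsStandardized (x i j) μ B) (hr : 0 < r) (hα : 0 < α) (hα1 : α ≤ 1) :
    IsMomentTable (r ^ 2) (α + r ^ 2 * B / α ^ 3)
      (entryMoment μ fun ω => Matrix.of fun i j => (r : ℂ) * truncate (α / r) (x i j ω)) where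
  zero e := by simp [entryMoment]
  two e a b hab := ((hx e.1 e.2).norm_jointMoment_truncate_le hr hα.le (k := 0) hab).trans_eq
    (by rw [pow_zero, mul_one])
  other e a b h0 h2 := by
    have hB := (hx e.1 e.2).bound_nonneg
    obtain h1 | ⟨k, hk⟩ : a + b = 1 ∨ ∃ k, a + b = k + 1 + 2 := by
      obtain h | h := Nat.lt_or_ge (a + b) 3
      · left; lia
      · exact Or.inr ⟨a + b - 3, by lia⟩
    · refine ((hx e.1 e.2).norm_jointMoment_truncate_of_add_eq_one_le hr hα h1).trans ?_
      gcongr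
      linarith
    · refine ((hx e.1 e.2).norm_jointMoment_truncate_le hr hα.le hk).trans ?_
      gcongr
      calc α ^ (k + 1) ≤ α := pow_le_of_le_one hα.le hα1 k.succ_ne_zero
        _ ≤ α + r ^ 2 * B / α ^ 3 := le_add_of_nonneg_right (by positivity)
  variance e := by
    have hB := (hx e.1 e.2).bound_nonneg
    refine ((hx e.1 e.2).norm_variance_truncate_sub_le hr hα).trans ?_
    gcongr r ^ 2 * ?_
    calc r ^ 2 * B / α ^ 2 ≤ r ^ 2 * B / α ^ 3 :=
          div_le_div_of_nonneg_left (by positivity) (by positivity)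
            (pow_le_pow_of_le_one hα.le hα1 (by norm_num))
      _ ≤ α + r ^ 2 * B / α ^ 3 := le_add_of_nonneg_left hα.le

end IsStandardized

end TruncatedMoments

/-! ### The limit law as a product of independent beta variables -/

section BetaMeasure

variable {a b : ℝ}

theorem beta_add_one (ha : 0 < a) (hb : 0 < b) : beta (a + 1) b = a / (a + b) * beta a b := by
  have hab : 0 < a + b := add_pos ha hb
  have hΓ := (Real.Gamma_pos_of_pos hab).ne'
  rw [beta, beta, add_right_comm, Real.Gamma_add_one ha.ne', Real.Gamma_add_one hab.ne']
  field_simp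

theorem beta_add_natCast (ha : 0 < a) (hb : 0 < b) (p : ℕ) :
    beta (a + p) b = (∏ i ∈ Finset.range p, (a + i) / (a + b + i)) * beta a b := by
  induction p with
  | zero => simp
  | succ p ih =>
    rw [Nat.cast_succ, ← add_assoc, beta_add_one (by positivity) hb, ih, Finset.prod_range_succ,
      add_right_comm a]
    ring

theorem betaPDFReal_nonneg (ha : 0 < a) (hb : 0 < b) (x : ℝ) : 0 ≤ betaPDFReal a b x := by
  by_cases hx : 0 < x ∧ x < 1
  · exact (betaPDFReal_pos hx.1 hx.2 ha hb).le
  · rw [betaPDFReal, if_neg hx]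

theorem betaPDFReal_mul_pow (ha : 0 < a) (hb : 0 < b) (p : ℕ) (x : ℝ) :
    betaPDFReal a b x * x ^ p = beta (a + p) b / beta a b * betaPDFReal (a + p) b x := by
  by_cases hx : 0 < x ∧ x < 1
  · have hbeta := (beta_pos (by positivity : 0 < a + p) hb).ne'
    have hpow : x ^ (a + p - 1) = x ^ (a - 1) * x ^ p := by
      rw [← Real.rpow_natCast x p, ← Real.rpow_add hx.1, add_sub_right_comm]
    rw [betaPDFReal, betaPDFReal, if_pos hx, if_pos hx, hpow]
    field_simp
  · rw [betaPDFReal, betaPDFReal, if_neg hx, if_neg hx, zero_mul, mul_zero]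

theorem measurable_betaPDF (a b : ℝ) : Measurable (betaPDF a b) :=
  (measurable_betaPDFReal a b).ennreal_ofReal

theorem integral_betaPDFReal (ha : 0 < a) (hb : 0 < b) : ∫ x, betaPDFReal a b x = 1 := by
  rw [integral_eq_lintegral_of_nonneg_ae (Eventually.of_forall (betaPDFReal_nonneg ha hb))
    (measurable_betaPDFReal a b).aestronglyMeasurable]
  exact (congrArg ENNReal.toReal (lintegral_betaPDF_eq_one ha hb)).trans ENNReal.toReal_one

theorem integral_pow_betaMeasure (ha : 0 < a) (hb : 0 < b) (p : ℕ) :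
    ∫ x, x ^ p ∂betaMeasure a b = ∏ i ∈ Finset.range p, (a + i) / (a + b + i) := by
  rw [betaMeasure, integral_withDensity_eq_integral_toReal_smul (measurable_betaPDF a b)
    (Eventually.of_forall fun _ => ENNReal.ofReal_lt_top)]
  simp only [betaPDF, ENNReal.toReal_ofReal (betaPDFReal_nonneg ha hb _), smul_eq_mul,
    betaPDFReal_mul_pow ha hb]
  rw [integral_const_mul, integral_betaPDFReal (by positivity) hb, mul_one,
    beta_add_natCast ha hb, mul_div_cancel_right₀ _ (beta_pos ha hb).ne']

theorem ae_betaMeasure_mem_Icc (a b : ℝ) : ∀ᵐ x ∂betaMeasure a b, x ∈ Set.Icc (0 : ℝ) 1 := by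
  rw [betaMeasure, ae_withDensity_iff (measurable_betaPDF a b)]
  refine Eventually.of_forall fun x hx => ⟨?_, ?_⟩ <;> contrapose! hx
  · exact betaPDF_eq_zero_of_nonpos hx.le
  · exact betaPDF_eq_zero_of_one_le hx.le

instance (a b : ℝ) : SFinite (betaMeasure a b) := by
  unfold betaMeasure
  infer_instance

instance (a b : ℝ) : NullSingletonClass (betaMeasure a b) :=
  ⟨fun _ => withDensity_absolutelyContinuous _ _ (by simp)⟩

end BetaMeasure

section MultiplicativeConvolution

theorem nullSingletonClass_mconv {G : Type*} [GroupWithZero G] [MeasurableSpace G]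
    [MeasurableMul₂ G] [MeasurableSingletonClass G] {μ ν : Measure G} [SFinite ν]
    [NullSingletonClass ν] (hμ : μ {0} = 0) : NullSingletonClass (μ.mconv ν) := by
  refine ⟨fun t => ?_⟩
  have ht : MeasurableSet ((fun z : G × G => z.1 * z.2) ⁻¹' {t}) :=
    measurable_mul (measurableSet_singleton t)
  rw [Measure.mconv, Measure.map_apply measurable_mul (measurableSet_singleton t),
    Measure.prod_apply ht, lintegral_eq_zero_iff (measurable_measure_prodMk_left ht)]
  filter_upwards [measure_eq_zero_iff_ae_notMem.1 hμ] with x hx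
  refine measure_mono_null (fun y hy => ?_) (measure_singleton (x⁻¹ * t))
  rw [Set.mem_singleton_iff, ← show x * y = t from hy, inv_mul_cancel_left₀ hx]

theorem ae_mconv_mem_Icc {μ ν : Measure ℝ} {K L : ℝ} (hμ : ∀ᵐ x ∂μ, x ∈ Set.Icc 0 K)
    (hν : ∀ᵐ y ∂ν, y ∈ Set.Icc 0 L) : ∀ᵐ z ∂μ.mconv ν, z ∈ Set.Icc 0 (K * L) := by
  refine (ae_map_iff (p := fun x => x ∈ Set.Icc 0 (K * L)) measurable_mul.aemeasurable
    measurableSet_Icc).2 ?_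
  filter_upwards [Measure.quasiMeasurePreserving_fst.ae hμ,
    Measure.quasiMeasurePreserving_snd.ae hν] with z hx hy
  exact ⟨mul_nonneg hx.1 hy.1, mul_le_mul hx.2 hy.2 hy.1 (hx.1.trans hx.2)⟩

theorem integral_pow_mconv (μ ν : Measure ℝ) [SFinite μ] [SFinite ν] (p : ℕ) :
    ∫ z, z ^ p ∂μ.mconv ν = (∫ x, x ^ p ∂μ) * ∫ y, y ^ p ∂ν := by
  rw [Measure.mconv, integral_map measurable_mul.aemeasurable
    (by fun_prop : Continuous fun x : ℝ => x ^ p).aestronglyMeasurable]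
  simp only [mul_pow]
  exact integral_prod_mul (fun x => x ^ p) (fun y => y ^ p)

end MultiplicativeConvolution

section BetaProduct

/-- The law of `K` times the product of `n` independent beta variables with parameters
`(a l, b l)`, `l < n`. -/
noncomputable def betaProductMeasure (K : ℝ) (a b : ℕ → ℝ) : ℕ → Measure ℝ
  | 0 => Measure.dirac K
  | n + 1 => (betaProductMeasure K a b n).mconv (betaMeasure (a n) (b n))

variable {K : ℝ} {a b : ℕ → ℝ}

theorem isProbabilityMeasure_betaProductMeasure (ha : ∀ l, 0 < a l) (hb : ∀ l, 0 < b l) (n : ℕ) :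
    IsProbabilityMeasure (betaProductMeasure K a b n) := by
  induction n with
  | zero => exact Measure.dirac.isProbabilityMeasure
  | succ n ih =>
    have := isProbabilityMeasureBeta (ha n) (hb n)
    rw [betaProductMeasure]
    infer_instance

theorem ae_betaProductMeasure_mem_Icc (hK : 0 ≤ K) (ha : ∀ l, 0 < a l) (hb : ∀ l, 0 < b l)
    (n : ℕ) : ∀ᵐ x ∂betaProductMeasure K a b n, x ∈ Set.Icc 0 K := by
  induction n with
  | zero =>
    rw [betaProductMeasure, ae_dirac_eq]
    exact ⟨hK, le_rfl⟩
  | succ n ih =>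
    have := isProbabilityMeasure_betaProductMeasure (K := K) ha hb n
    have := isProbabilityMeasureBeta (ha n) (hb n)
    simpa only [betaProductMeasure, mul_one] using
      ae_mconv_mem_Icc ih (ae_betaMeasure_mem_Icc (a n) (b n))

theorem betaProductMeasure_singleton_zero (hK : K ≠ 0) (a b : ℕ → ℝ) (n : ℕ) :
    betaProductMeasure K a b n {0} = 0 := by
  induction n with
  | zero => simp [betaProductMeasure, hK]
  | succ n ih =>
    have := nullSingletonClass_mconv (ν := betaMeasure (a n) (b n)) ih
    exact measure_singleton (μ := (betaProductMeasure K a b n).mconv _) 0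

theorem nullSingletonClass_betaProductMeasure (hK : K ≠ 0) (a b : ℕ → ℝ) {n : ℕ} (hn : n ≠ 0) :
    NullSingletonClass (betaProductMeasure K a b n) := by
  obtain ⟨n, rfl⟩ := Nat.exists_eq_succ_of_ne_zero hn
  exact nullSingletonClass_mconv (betaProductMeasure_singleton_zero hK a b n)

theorem integral_pow_betaProductMeasure (K : ℝ) (ha : ∀ l, 0 < a l) (hb : ∀ l, 0 < b l)
    (n p : ℕ) : ∫ x, x ^ p ∂betaProductMeasure K a b n =
      K ^ p * ∏ l ∈ Finset.range n, ∏ i ∈ Finset.range p, (a l + i) / (a l + b l + i) := by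
  induction n with
  | zero => simp [betaProductMeasure]
  | succ n ih =>
    have := isProbabilityMeasure_betaProductMeasure (K := K) ha hb n
    rw [betaProductMeasure, integral_pow_mconv, ih, integral_pow_betaMeasure (ha n) (hb n),
      Finset.prod_range_succ, mul_assoc]

end BetaProduct

section FussCatalanMeasure

open Nat in
theorem fussCatalan_eq_factorial_div (m p : ℕ) :
    fussCatalan m p = ((m * p + p)! : ℝ) / (p ! * (m * p + 1)!) := by
  rw [fussCatalan, Nat.cast_choose ℝ (Nat.le_add_left p (m * p)), Nat.add_sub_cancel,
    Nat.factorial_succ]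
  push_cast
  field_simp

open Nat in
theorem factorial_add_eq_mul_prod (n k : ℕ) :
    ((n + k)! : ℝ) = n ! * ∏ l ∈ Finset.range k, ((n : ℝ) + (l + 1)) := by
  rw [← Nat.factorial_mul_ascFactorial, Nat.ascFactorial_eq_prod_range]
  push_cast
  simp only [add_assoc, add_comm (1 : ℝ)]

theorem fussCatalan_succ (m p : ℕ) :
    fussCatalan m (p + 1) =
      (m + 1) * (∏ l ∈ Finset.range m, (((m : ℝ) + 1) * p + (l + 1)) / (m * p + (l + 2))) *
        fussCatalan m p := by
  have hnum := factorial_add_eq_mul_prod (m * p + p) (m + 1)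
  have hden := factorial_add_eq_mul_prod (m * p + 1) m
  rw [Finset.prod_range_succ] at hnum
  rw [fussCatalan_eq_factorial_div, fussCatalan_eq_factorial_div,
    show m * (p + 1) + (p + 1) = m * p + p + (m + 1) by ring,
    show m * (p + 1) + 1 = m * p + 1 + m by ring, hnum, hden, Nat.factorial_succ p,
    Finset.prod_div_distrib]
  have hnum_factor (l : ℕ) : ((m * p + p : ℕ) : ℝ) + (l + 1) = (m + 1) * p + (l + 1) := by
    push_cast; ring
  have hden_factor (l : ℕ) : ((m * p + 1 : ℕ) : ℝ) + (l + 1) = m * p + (l + 2) := by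
    push_cast; ring
  simp only [hnum_factor, hden_factor]
  have hprod : ∏ l ∈ Finset.range m, ((m : ℝ) * p + (l + 2)) ≠ 0 :=
    Finset.prod_ne_zero_iff.2 fun l _ => by positivity
  push_cast
  field_simp

theorem prod_pochhammer_eq_fussCatalan {m : ℕ} (hm : 1 ≤ m) (p : ℕ) :
    (((m : ℝ) + 1) ^ (m + 1) / (m : ℝ) ^ m) ^ p *
      ∏ l ∈ Finset.range m, ∏ i ∈ Finset.range p,
        (((l : ℝ) + 1) / (m + 1) + i) / (((l : ℝ) + 2) / m + i) = fussCatalan m p := by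
  have hm0 : (m : ℝ) ≠ 0 := by positivity
  induction p with
  | zero => simp [fussCatalan]
  | succ p ih =>
    have hfactor (l : ℕ) : (((l : ℝ) + 1) / (m + 1) + p) / (((l : ℝ) + 2) / m + p) =
        m / (m + 1) * ((((m : ℝ) + 1) * p + (l + 1)) / (m * p + (l + 2))) := by
      field_simp
      ring
    simp only [fussCatalan_succ, ← ih, Finset.prod_range_succ _ p, Finset.prod_mul_distrib, hfactor,
      Finset.prod_const, Finset.card_range, div_pow, pow_succ]
    field_simp

/-- The Fuss–Catalan law: the product of `m` independent beta variables with parameters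
`((l + 1) / (m + 1), (l + 2) / m - (l + 1) / (m + 1))`, `l < m`, scaled to the support
`[0, (m + 1) ^ (m + 1) / m ^ m]`. The parameters are chosen so that the `p`-th moment is a product
of quotients of Pochhammer symbols. -/
noncomputable def fussCatalanMeasure (m : ℕ) : Measure ℝ :=
  betaProductMeasure (((m : ℝ) + 1) ^ (m + 1) / (m : ℝ) ^ m) (fun l => ((l : ℝ) + 1) / (m + 1))
    (fun l => ((l : ℝ) + 2) / m - ((l : ℝ) + 1) / (m + 1)) m

variable {m : ℕ}

theorem fussCatalanMeasure_second_param_pos (hm : 1 ≤ m) (l : ℕ) :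
    0 < ((l : ℝ) + 2) / m - ((l : ℝ) + 1) / (m + 1) := by
  have hm0 : (0 : ℝ) < m := by positivity
  rw [sub_pos, div_lt_div_iff₀ (by positivity) hm0]
  nlinarith [(Nat.cast_nonneg l : (0 : ℝ) ≤ l)]

theorem isProbabilityMeasure_fussCatalanMeasure (hm : 1 ≤ m) :
    IsProbabilityMeasure (fussCatalanMeasure m) :=
  isProbabilityMeasure_betaProductMeasure (fun _ => by positivity)
    (fussCatalanMeasure_second_param_pos hm) m

theorem ae_abs_le_fussCatalanMeasure (hm : 1 ≤ m) :
    ∀ᵐ x ∂fussCatalanMeasure m, |x| ≤ ((m : ℝ) + 1) ^ (m + 1) / (m : ℝ) ^ m := by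
  filter_upwards [ae_betaProductMeasure_mem_Icc (by positivity) (fun _ => by positivity)
    (fussCatalanMeasure_second_param_pos hm) m] with x hx
  exact (abs_of_nonneg hx.1).trans_le hx.2

theorem nullSingletonClass_fussCatalanMeasure (hm : 1 ≤ m) :
    NullSingletonClass (fussCatalanMeasure m) :=
  nullSingletonClass_betaProductMeasure (by positivity) _ _ (by lia)

theorem integral_pow_fussCatalanMeasure (hm : 1 ≤ m) (p : ℕ) :
    ∫ x, x ^ p ∂fussCatalanMeasure m = fussCatalan m p := by
  rw [fussCatalanMeasure, integral_pow_betaProductMeasure _ (fun _ => by positivity)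
    (fussCatalanMeasure_second_param_pos hm), ← prod_pochhammer_eq_fussCatalan hm]
  simp only [add_sub_cancel]

end FussCatalanMeasure

/-! ### The method of moments -/

section PolynomialApproximation

theorem exists_abs_polynomial_eval_le_mul_pow (P : Polynomial ℝ) {L : ℝ} (hL : 0 < L) :
    ∃ C : ℝ, 0 ≤ C ∧ ∀ q ≥ P.natDegree, ∀ x : ℝ, L ≤ |x| → |P.eval x| ≤ C * (|x| / L) ^ q := by
  refine ⟨∑ i ∈ Finset.range (P.natDegree + 1), |P.coeff i| * L ^ i,
    Finset.sum_nonneg fun i _ => by positivity, fun q hq x hx => ?_⟩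
  have hxL : 1 ≤ |x| / L := (one_le_div hL).2 hx
  rw [Polynomial.eval_eq_sum_range, Finset.sum_mul]
  refine (Finset.abs_sum_le_sum_abs _ _).trans (Finset.sum_le_sum fun i hi => ?_)
  have hiq : i ≤ q := (Finset.mem_range_succ_iff.1 hi).trans hq
  calc |P.coeff i * x ^ i| = |P.coeff i| * (L ^ i * (|x| / L) ^ i) := by
        rw [abs_mul, abs_pow, ← mul_pow, mul_div_cancel₀ _ hL.ne']
    _ ≤ |P.coeff i| * (L ^ i * (|x| / L) ^ q) := by gcongr
    _ = |P.coeff i| * L ^ i * (|x| / L) ^ q := (mul_assoc _ _ _).symm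

theorem exists_polynomial_abs_sub_le_add_mul_pow (f : BoundedContinuousFunction ℝ ℝ) {L ε : ℝ}
    (hL : 0 < L) (hε : 0 < ε) :
    ∃ (P : Polynomial ℝ) (C : ℝ), 0 ≤ C ∧
      ∀ q ≥ P.natDegree, ∀ x, |f x - P.eval x| ≤ ε + C * (|x| / L) ^ q := by
  obtain ⟨P, hP⟩ :=
    exists_polynomial_near_of_continuousOn (-L) L f f.continuous.continuousOn ε hε
  obtain ⟨C, hC, hPC⟩ := exists_abs_polynomial_eval_le_mul_pow P hL
  refine ⟨P, ‖f‖ + C, by positivity, fun q hq x => ?_⟩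
  rcases le_total |x| L with hx | hx
  · have hnear := (hP x (abs_le.1 hx)).le
    rw [abs_sub_comm] at hnear
    exact hnear.trans (le_add_of_nonneg_right (by positivity))
  · have hf : |f x| ≤ ‖f‖ * (|x| / L) ^ q := (f.norm_coe_le_norm x).trans
      (le_mul_of_one_le_right (norm_nonneg f) (one_le_pow₀ ((one_le_div hL).2 hx)))
    calc |f x - P.eval x| ≤ |f x| + |P.eval x| := abs_sub _ _
      _ ≤ (‖f‖ + C) * (|x| / L) ^ q := by linarith [hPC q hq x hx]
      _ ≤ ε + (‖f‖ + C) * (|x| / L) ^ q := le_add_of_nonneg_left hε.le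

-- Outside `[-L, L]` with `L > K`, the error is dominated by a high even power of `x / L`, which is
-- negligible on `[-K, K]`.
theorem exists_polynomial_abs_sub_le_add_mul_even_pow (f : BoundedContinuousFunction ℝ ℝ)
    {K ε : ℝ} (hK : 0 ≤ K) (hε : 0 < ε) :
    ∃ (P : Polynomial ℝ) (D : ℝ) (q : ℕ), 0 ≤ D ∧ D * K ^ (2 * q) < ε ∧
      ∀ x, |f x - P.eval x| ≤ ε + D * x ^ (2 * q) := by
  have hL : 0 < K + 1 := by positivity
  obtain ⟨P, C, hC, hP⟩ := exists_polynomial_abs_sub_le_add_mul_pow f hL hε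
  have hlim : Tendsto (fun q : ℕ => C * (K / (K + 1)) ^ q) atTop (𝓝 0) := by
    simpa using (tendsto_pow_atTop_nhds_zero_of_lt_one (by positivity)
      ((div_lt_one hL).2 (lt_add_one K))).const_mul C
  obtain ⟨Q, hQ⟩ := eventually_atTop.1 (hlim.eventually_lt_const hε)
  set q := max P.natDegree Q
  refine ⟨P, C / (K + 1) ^ (2 * q), q, by positivity, ?_, fun x => ?_⟩
  · have hq := hQ (2 * q) (by lia)
    rwa [div_pow, mul_div_left_comm, mul_comm] at hq
  · have hq := hP (2 * q) (by lia) x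
    rwa [div_pow, (even_two_mul q).pow_abs, mul_div_left_comm, mul_comm (x ^ _)] at hq

end PolynomialApproximation

section MethodOfMoments

variable {μ : Measure ℝ}

theorem integrable_polynomial_eval (hint : ∀ p : ℕ, Integrable (fun x => x ^ p) μ)
    (P : Polynomial ℝ) : Integrable (fun x => P.eval x) μ := by
  simp only [Polynomial.eval_eq_sum_range]
  exact integrable_finsetSum _ fun i _ => (hint i).const_mul _

theorem integral_polynomial_eval (hint : ∀ p : ℕ, Integrable (fun x => x ^ p) μ)
    (P : Polynomial ℝ) :
    ∫ x, P.eval x ∂μ = ∑ i ∈ Finset.range (P.natDegree + 1), P.coeff i * ∫ x, x ^ i ∂μ := by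
  simp only [Polynomial.eval_eq_sum_range]
  rw [integral_finsetSum _ fun i _ => (hint i).const_mul _]
  simp only [integral_const_mul]

theorem abs_integral_sub_integral_le_of_abs_sub_le [IsProbabilityMeasure μ] {f g h : ℝ → ℝ}
    (hf : Integrable f μ) (hg : Integrable g μ) (hh : Integrable h μ) {ε D : ℝ}
    (hfg : ∀ x, |f x - g x| ≤ ε + D * h x) :
    |∫ x, f x ∂μ - ∫ x, g x ∂μ| ≤ ε + D * ∫ x, h x ∂μ := by
  have hbound : ∫ x, (ε + D * h x) ∂μ = ε + D * ∫ x, h x ∂μ := by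
    rw [integral_add (integrable_const _) (hh.const_mul _), integral_const_mul, integral_const,
      probReal_univ, one_smul]
  rw [← integral_sub hf hg, ← hbound]
  exact norm_integral_le_of_norm_le (f := fun x => f x - g x) (g := fun x => ε + D * h x)
    ((integrable_const ε).add (hh.const_mul D)) (Eventually.of_forall hfg)

theorem integrable_pow_of_ae_abs_le [IsFiniteMeasure μ] {K : ℝ} (hμ : ∀ᵐ x ∂μ, |x| ≤ K) (p : ℕ) :
    Integrable (fun x => x ^ p) μ := by
  refine Integrable.of_bound (C := K ^ p)
    (by fun_prop : Continuous fun x : ℝ => x ^ p).aestronglyMeasurable ?_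
  filter_upwards [hμ] with x hx
  rw [norm_pow]
  exact pow_le_pow_left₀ (abs_nonneg x) hx p

theorem integral_pow_le_of_ae_abs_le [IsProbabilityMeasure μ] {K : ℝ} (hμ : ∀ᵐ x ∂μ, |x| ≤ K)
    (p : ℕ) : ∫ x, x ^ p ∂μ ≤ K ^ p := by
  have hle : ∫ x, x ^ p ∂μ ≤ ∫ _, K ^ p ∂μ := by
    refine integral_mono_ae (integrable_pow_of_ae_abs_le hμ p) (integrable_const _) ?_
    filter_upwards [hμ] with x hx
    exact (le_abs_self _).trans ((abs_pow x p).trans_le (pow_le_pow_left₀ (abs_nonneg x) hx p))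
  simpa using hle

variable {ι : Type*} {l : Filter ι} {μ : ι → Measure ℝ} [∀ i, IsProbabilityMeasure (μ i)]
  {ν : Measure ℝ} [IsProbabilityMeasure ν] {K : ℝ}

theorem tendsto_integral_of_tendsto_moments (hν : ∀ᵐ x ∂ν, |x| ≤ K)
    (hint : ∀ i (p : ℕ), Integrable (fun x => x ^ p) (μ i))
    (hmom : ∀ p : ℕ, Tendsto (fun i => ∫ x, x ^ p ∂μ i) l (𝓝 (∫ x, x ^ p ∂ν)))
    (f : BoundedContinuousFunction ℝ ℝ) :
    Tendsto (fun i => ∫ x, f x ∂μ i) l (𝓝 (∫ x, f x ∂ν)) := by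
  rw [Metric.tendsto_nhds]
  intro δ hδ
  obtain ⟨ε, hε, hεδ⟩ : ∃ ε : ℝ, 0 < ε ∧ 6 * ε = δ := ⟨δ / 6, by positivity, by ring⟩
  obtain ⟨x₀, hx₀⟩ := hν.exists
  obtain ⟨P, D, q, hD, hDK, hfP⟩ :=
    exists_polynomial_abs_sub_le_add_mul_even_pow f ((abs_nonneg x₀).trans hx₀) hε
  have hintν := integrable_pow_of_ae_abs_le hν
  have hDν : D * ∫ x, x ^ (2 * q) ∂ν < ε :=
    (mul_le_mul_of_nonneg_left (integral_pow_le_of_ae_abs_le hν _) hD).trans_lt hDK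
  have hfPν := abs_integral_sub_integral_le_of_abs_sub_le (f.integrable ν)
    (integrable_polynomial_eval hintν P) (hintν _) hfP
  have hPlim : Tendsto (fun i => ∫ x, P.eval x ∂μ i) l (𝓝 (∫ x, P.eval x ∂ν)) := by
    simp only [integral_polynomial_eval hintν, fun i => integral_polynomial_eval (hint i) P]
    exact tendsto_finsetSum _ fun j _ => (hmom j).const_mul _
  filter_upwards [((hmom (2 * q)).const_mul D).eventually_lt_const hDν,
    Metric.tendsto_nhds.1 hPlim ε hε] with i hDi hPi
  have hfPi := abs_integral_sub_integral_le_of_abs_sub_le (f.integrable (μ i))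
    (integrable_polynomial_eval (hint i) P) (hint i _) hfP
  rw [Real.dist_eq] at hPi ⊢
  rw [abs_le] at hfPi hfPν
  rw [abs_lt] at hPi ⊢
  constructor <;> linarith [hfPi.1, hfPi.2, hfPν.1, hfPν.2, hPi.1, hPi.2]

theorem tendsto_measureReal_Iic_of_tendsto_moments [NullSingletonClass ν]
    (hν : ∀ᵐ x ∂ν, |x| ≤ K) (hint : ∀ i (p : ℕ), Integrable (fun x => x ^ p) (μ i))
    (hmom : ∀ p : ℕ, Tendsto (fun i => ∫ x, x ^ p ∂μ i) l (𝓝 (∫ x, x ^ p ∂ν))) (t : ℝ) :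
    Tendsto (fun i => (μ i).real (Set.Iic t)) l (𝓝 (ν.real (Set.Iic t))) := by
  let μ' (i : ι) : ProbabilityMeasure ℝ := ⟨μ i, inferInstance⟩
  let ν' : ProbabilityMeasure ℝ := ⟨ν, inferInstance⟩
  have hweak : Tendsto μ' l (𝓝 ν') :=
    ProbabilityMeasure.tendsto_iff_forall_integral_tendsto.2
      (tendsto_integral_of_tendsto_moments hν hint hmom)
  have hfrontier : (ν' : Measure ℝ) (frontier (Set.Iic t)) = 0 := by
    rw [frontier_Iic]
    exact measure_singleton (μ := ν) t
  exact (ENNReal.tendsto_toReal (measure_ne_top ν _)).comp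
    (ProbabilityMeasure.tendsto_measure_of_null_frontier_of_tendsto' hweak hfrontier)

end MethodOfMoments

/-! ### The expected spectral measure of a random Hermitian matrix -/

section MeasurableMatrix

variable {Ω n R : Type*} [MeasurableSpace Ω] [Fintype n] [Semiring R] [MeasurableSpace R]
  [MeasurableAdd₂ R] [MeasurableMul₂ R]

theorem measurable_matrix_mul {A B : Ω → Matrix n n R} (hA : ∀ i j, Measurable fun ω => A ω i j)
    (hB : ∀ i j, Measurable fun ω => B ω i j) (i j : n) : Measurable fun ω => (A ω * B ω) i j := by
  simp only [Matrix.mul_apply]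
  exact Finset.measurable_fun_sum _ fun k _ => (hA i k).mul (hB k j)

theorem measurable_matrix_pow [DecidableEq n] {A : Ω → Matrix n n R}
    (hA : ∀ i j, Measurable fun ω => A ω i j) (p : ℕ) (i j : n) :
    Measurable fun ω => (A ω ^ p) i j := by
  induction p generalizing i j with
  | zero => simp only [pow_zero, measurable_const]
  | succ p ih =>
    simp only [pow_succ]
    exact measurable_matrix_mul ih hA i j

end MeasurableMatrix

section MeasurableEigenvalues

variable {Ω n : Type*} [MeasurableSpace Ω] [Fintype n] [DecidableEq n] {A : Ω → Matrix n n ℂ}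

theorem measurable_sum_eigenvalues_pow (hA : ∀ ω, (A ω).IsHermitian)
    (hAm : ∀ i j, Measurable fun ω => A ω i j) (p : ℕ) :
    Measurable fun ω => ∑ k, (hA ω).eigenvalues k ^ p := by
  have htrace : Measurable fun ω => (A ω ^ p).trace :=
    Finset.measurable_fun_sum _ fun k _ => measurable_matrix_pow hAm p k k
  convert Complex.measurable_re.comp htrace using 2 with ω
  rw [Function.comp_apply, ← sum_eigenvalues_pow (hA ω)]
  norm_cast

theorem exists_polynomial_tendsto_eval {f : ℝ → ℝ} (hf : Continuous f) :
    ∃ P : ℕ → Polynomial ℝ, ∀ x, Tendsto (fun k => (P k).eval x) atTop (𝓝 (f x)) := by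
  choose P hP using fun k : ℕ => exists_polynomial_near_of_continuousOn (-(k : ℝ)) k f
    hf.continuousOn (1 / ((k : ℝ) + 1)) (by positivity)
  refine ⟨P, fun x => tendsto_iff_norm_sub_tendsto_zero.2 ?_⟩
  refine squeeze_zero' (Eventually.of_forall fun _ => norm_nonneg _) ?_
    tendsto_one_div_add_atTop_nhds_zero_nat
  filter_upwards [tendsto_natCast_atTop_atTop.eventually_ge_atTop |x|] with k hk
  exact (hP k x (abs_le.1 hk)).le

theorem measurable_sum_eigenvalues (hA : ∀ ω, (A ω).IsHermitian)
    (hAm : ∀ i j, Measurable fun ω => A ω i j) {f : ℝ → ℝ} (hf : Continuous f) :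
    Measurable fun ω => ∑ k, f ((hA ω).eigenvalues k) := by
  obtain ⟨P, hP⟩ := exists_polynomial_tendsto_eval hf
  refine measurable_of_tendsto_metrizable (f := fun m ω => ∑ k, (P m).eval ((hA ω).eigenvalues k))
    (fun m => ?_) (tendsto_pi_nhds.2 fun ω => tendsto_finsetSum _ fun k _ => hP _)
  simp only [Polynomial.eval_eq_sum_range, Finset.sum_comm (s := Finset.univ), ← Finset.mul_sum]
  exact Finset.measurable_fun_sum _ fun i _ =>
    (measurable_sum_eigenvalues_pow hA hAm i).const_mul _

end MeasurableEigenvalues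

section SpectralMeasure

variable {n 𝕜 : Type*} [Fintype n] [DecidableEq n] [RCLike 𝕜] {A : Matrix n n 𝕜}

/-- The empirical spectral measure of a Hermitian matrix: the uniform probability measure on its
eigenvalues, counted with multiplicity. -/
noncomputable def spectralMeasure (hA : A.IsHermitian) : Measure ℝ :=
  (Fintype.card n : ENNReal)⁻¹ • ∑ k, Measure.dirac (hA.eigenvalues k)

theorem integral_spectralMeasure (hA : A.IsHermitian) (f : ℝ → ℝ) :
    ∫ x, f x ∂spectralMeasure hA = (Fintype.card n : ℝ)⁻¹ * ∑ k, f (hA.eigenvalues k) := by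
  rw [spectralMeasure, integral_smul_measure, integral_finsetSum_measure fun k _ =>
    integrable_dirac (by finiteness)]
  simp

theorem integral_pow_spectralMeasure (hA : A.IsHermitian) (p : ℕ) :
    ∫ x, x ^ p ∂spectralMeasure hA = (Fintype.card n : ℝ)⁻¹ * RCLike.re (A ^ p).trace := by
  rw [integral_spectralMeasure, ← sum_eigenvalues_pow hA]
  norm_cast

theorem spectralMeasure_real_Iic {N : ℕ} {A : Matrix (Fin N) (Fin N) ℂ} (hA : A.IsHermitian)
    (t : ℝ) : (spectralMeasure hA).real (Set.Iic t) = empiricalSpectralDistribution hA t := by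
  rw [← integral_indicator_one measurableSet_Iic, integral_spectralMeasure, Fintype.card_fin]
  rfl

variable [Nonempty n]

instance (hA : A.IsHermitian) : IsProbabilityMeasure (spectralMeasure hA) := by
  constructor
  simp [spectralMeasure, ENNReal.inv_mul_cancel]

theorem integrable_spectralMeasure (hA : A.IsHermitian) (f : ℝ → ℝ) :
    Integrable f (spectralMeasure hA) :=
  (integrable_finsetSum_measure.2 fun _ _ => integrable_dirac (by finiteness)).smul_measure
    (by simp)

end SpectralMeasure

section ExpectedSpectralMeasure

theorem measurable_of_forall_measurable_lintegral {Ω E : Type*} [MeasurableSpace Ω]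
    [TopologicalSpace E] [MeasurableSpace E] [BorelSpace E] [HasOuterApproxClosed E]
    {κ : Ω → Measure E} [∀ ω, IsProbabilityMeasure (κ ω)]
    (hκ : ∀ f : BoundedContinuousFunction E NNReal, Measurable fun ω => ∫⁻ x, f x ∂κ ω) :
    Measurable κ :=
  .measure_of_isPiSystem_of_isProbabilityMeasure
    (BorelSpace.measurable_eq.trans borel_eq_generateFrom_isClosed) isPiSystem_isClosed
    fun _ hF => measurable_of_tendsto_metrizable (fun _ => hκ _)
      (tendsto_pi_nhds.2 fun ω =>
        HasOuterApproxClosed.tendsto_lintegral_apprSeq hF (κ ω))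

theorem integral_measure_comp {α β E : Type*} [MeasurableSpace α] [MeasurableSpace β]
    [NormedAddCommGroup E] [NormedSpace ℝ E] {μ : Measure α} {κ : Kernel α β} {f : β → E}
    (hf : Integrable f (κ ∘ₘ μ)) : ∫ x, f x ∂(κ ∘ₘ μ) = ∫ a, ∫ x, f x ∂κ a ∂μ := by
  rw [Measure.comp_eq_comp_const_apply] at hf ⊢
  rw [Kernel.integral_comp hf, Kernel.const_apply]

variable {Ω n : Type*} [MeasurableSpace Ω] [Fintype n] [DecidableEq n] {A : Ω → Matrix n n ℂ}

/-- The expected spectral measure of a random Hermitian matrix, that is, the mixture of its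
empirical spectral measures. -/
noncomputable def expectedSpectralMeasure (P : Measure Ω) (hA : ∀ ω, (A ω).IsHermitian) :
    Measure ℝ :=
  P.bind fun ω => spectralMeasure (hA ω)

variable [Nonempty n] {P : Measure Ω} (hA : ∀ ω, (A ω).IsHermitian)
  (hAm : ∀ i j, Measurable fun ω => A ω i j)

include hAm

theorem measurable_spectralMeasure : Measurable fun ω => spectralMeasure (hA ω) := by
  refine measurable_of_forall_measurable_lintegral fun f => ?_
  have hsum := measurable_sum_eigenvalues hA hAm (NNReal.continuous_coe.comp f.continuous)
  convert hsum.ennreal_ofReal.const_mul (Fintype.card n : ENNReal)⁻¹ using 2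
  simp only [spectralMeasure, lintegral_smul_measure, lintegral_finsetSum_measure, lintegral_dirac,
    Function.comp_apply, ← NNReal.coe_sum, ENNReal.ofReal_coe_nnreal, ENNReal.ofNNReal_finsetSum,
    smul_eq_mul]

theorem isProbabilityMeasure_expectedSpectralMeasure [IsProbabilityMeasure P] :
    IsProbabilityMeasure (expectedSpectralMeasure P hA) :=
  isProbabilityMeasure_bind (measurable_spectralMeasure hA hAm).aemeasurable
    (Eventually.of_forall fun _ => inferInstance)

theorem expectedSpectralMeasure_real {s : Set ℝ} (hs : MeasurableSet s) :
    (expectedSpectralMeasure P hA).real s = ∫ ω, (spectralMeasure (hA ω)).real s ∂P := by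
  have hm := measurable_spectralMeasure hA hAm
  rw [measureReal_def, expectedSpectralMeasure, Measure.bind_apply hs hm.aemeasurable]
  exact (integral_toReal ((Measure.measurable_coe hs).comp hm).aemeasurable
    (Eventually.of_forall fun _ => measure_lt_top _ _)).symm

variable (hint : ∀ p : ℕ, Integrable (fun ω => (A ω ^ p).trace) P)

include hint

theorem integrable_even_pow_expectedSpectralMeasure (p : ℕ) :
    Integrable (fun x => x ^ (2 * p)) (expectedSpectralMeasure P hA) := by
  let κ : Kernel Ω ℝ := ⟨_, measurable_spectralMeasure hA hAm⟩
  refine (Measure.integrable_comp_iff (κ := κ)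
    (by fun_prop : Continuous fun x : ℝ => x ^ (2 * p)).aestronglyMeasurable).2
    ⟨Eventually.of_forall fun ω => integrable_spectralMeasure (hA ω) _, ?_⟩
  refine ((hint (2 * p)).re.const_mul (Fintype.card n : ℝ)⁻¹).congr
    (Eventually.of_forall fun ω => ?_)
  simp only [Real.norm_of_nonneg ((even_two_mul p).pow_nonneg _)]
  exact (integral_pow_spectralMeasure (hA ω) (2 * p)).symm

variable [IsProbabilityMeasure P]

theorem integrable_pow_expectedSpectralMeasure (p : ℕ) :
    Integrable (fun x => x ^ p) (expectedSpectralMeasure P hA) := by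
  have := isProbabilityMeasure_expectedSpectralMeasure (P := P) hA hAm
  have heven := integrable_even_pow_expectedSpectralMeasure hA hAm hint p
  refine ((integrable_const 1).add heven).mono'
    (by fun_prop : Continuous fun x : ℝ => x ^ p).aestronglyMeasurable
    (Eventually.of_forall fun x => ?_)
  rw [Pi.add_apply, mul_comm 2 p, pow_mul, Real.norm_eq_abs]
  nlinarith [sq_nonneg (|x ^ p| - 1), sq_abs (x ^ p), sq_nonneg (x ^ p)]

theorem integral_pow_expectedSpectralMeasure (p : ℕ) :
    ∫ x, x ^ p ∂expectedSpectralMeasure P hA =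
      (Fintype.card n : ℝ)⁻¹ * ∫ ω, (A ω ^ p).trace.re ∂P := by
  let κ : Kernel Ω ℝ := ⟨_, measurable_spectralMeasure hA hAm⟩
  have hbind : ∫ x, x ^ p ∂expectedSpectralMeasure P hA =
      ∫ ω, ∫ x, x ^ p ∂spectralMeasure (hA ω) ∂P :=
    integral_measure_comp (κ := κ) (integrable_pow_expectedSpectralMeasure hA hAm hint p)
  simp only [hbind, integral_pow_spectralMeasure, integral_const_mul, RCLike.re_eq_complex_re]

end ExpectedSpectralMeasure

/-! ### Comparison with truncated entries -/

section BadEvent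

variable {Ω : Type*} [MeasurableSpace Ω] {P : Measure Ω}

theorem pow_mul_measureReal_norm_gt_le [IsFiniteMeasure P] {E : Type*} [NormedAddCommGroup E]
    [MeasurableSpace E] [OpensMeasurableSpace E] {f : Ω → E} (hf : Measurable f) {c : ℝ}
    (hc : 0 ≤ c) {n : ℕ} (hint : Integrable (fun ω => ‖f ω‖ ^ n) P) :
    c ^ n * P.real {ω | c < ‖f ω‖} ≤
      ∫ ω, Set.indicator {ω | c < ‖f ω‖} (fun ω => ‖f ω‖ ^ n) ω ∂P := by
  have hs : MeasurableSet {ω | c < ‖f ω‖} := measurableSet_lt measurable_const hf.norm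
  rw [integral_indicator hs]
  refine setIntegral_ge_of_const_le_real hs (measure_ne_top _ _) (fun ω hω => ?_)
    hint.integrableOn
  gcongr
  exact le_of_lt hω

theorem abs_integral_sub_integral_le_measureReal_ne [IsFiniteMeasure P] {f g : Ω → ℝ}
    (hf : Measurable f) (hg : Measurable g) (hf01 : ∀ ω, f ω ∈ Set.Icc 0 1)
    (hg01 : ∀ ω, g ω ∈ Set.Icc 0 1) :
    |∫ ω, f ω ∂P - ∫ ω, g ω ∂P| ≤ P.real {ω | f ω ≠ g ω} := by
  have hint : ∀ {h : Ω → ℝ}, Measurable h → (∀ ω, h ω ∈ Set.Icc 0 1) → Integrable h P :=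
    fun hh hh01 => .of_mem_Icc 0 1 hh.aemeasurable (Eventually.of_forall hh01)
  have hs : MeasurableSet {ω | f ω ≠ g ω} := (measurableSet_eq_fun hf hg).compl
  rw [← integral_sub (hint hf hf01) (hint hg hg01), ← integral_indicator_one hs,
    ← Real.norm_eq_abs]
  refine norm_integral_le_of_norm_le ((integrable_const 1).indicator hs)
    (Eventually.of_forall fun ω => ?_)
  by_cases h : f ω = g ω
  · simp [h]
  · rw [Set.indicator_of_mem h]
    exact abs_sub_le_of_nonneg_of_le (hf01 ω).1 (hf01 ω).2 (hg01 ω).1 (hg01 ω).2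

variable {N : ℕ} {x : Fin N → Fin N → Ω → ℂ}

theorem measureReal_exists_norm_gt_le_lindebergFourth [IsFiniteMeasure P]
    (hx : ∀ i j, Measurable (x i j)) (hint : ∀ i j, Integrable (fun ω => ‖x i j ω‖ ^ 4) P)
    {α : ℝ} (hα : 0 < α) :
    P.real {ω | ∃ i j, α * √N < ‖x i j ω‖} ≤ lindebergFourth P x α / α ^ 4 := by
  obtain rfl | hN := eq_or_ne N 0
  · simp [lindebergFourth]
  have hN' : (0 : ℝ) < N := by positivity
  have hunion : P.real {ω | ∃ i j, α * √N < ‖x i j ω‖} ≤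
      ∑ i, ∑ j, P.real {ω | α * √N < ‖x i j ω‖} := by
    simp only [Set.ofPred_exists]
    exact (measureReal_iUnion_fintype_le _).trans
      (Finset.sum_le_sum fun i _ => measureReal_iUnion_fintype_le _)
  have hlevel : (α * √N) ^ 4 = α ^ 4 * (N : ℝ) ^ 2 := by
    rw [mul_pow, show 4 = 2 * 2 from rfl, pow_mul (√N), Real.sq_sqrt hN'.le]
  have hmarkov := Finset.sum_le_sum fun i (_ : i ∈ Finset.univ) =>
    Finset.sum_le_sum fun j (_ : j ∈ Finset.univ) =>
      pow_mul_measureReal_norm_gt_le (hx i j) (by positivity : 0 ≤ α * √N) (hint i j)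
  simp only [← Finset.mul_sum, hlevel] at hmarkov
  rw [lindebergFourth, le_div_iff₀ (by positivity),
    le_inv_mul_iff₀ (by positivity)]
  refine le_trans ?_ hmarkov
  calc (N : ℝ) ^ 2 * (P.real {ω | ∃ i j, α * √N < ‖x i j ω‖} * α ^ 4)
      = α ^ 4 * (N : ℝ) ^ 2 * P.real {ω | ∃ i j, α * √N < ‖x i j ω‖} := by ring
    _ ≤ α ^ 4 * (N : ℝ) ^ 2 * ∑ i, ∑ j, P.real {ω | α * √N < ‖x i j ω‖} := by gcongr

end BadEvent

section Comparison

variable {Ω : Type*} {N : ℕ} {x : Fin N → Fin N → Ω → ℂ} {α : ℝ}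

/-- The matrix entries truncated at level `α √N`, so that the normalised entries are bounded by
`α`. -/
noncomputable def truncateEntries (α : ℝ) (x : Fin N → Fin N → Ω → ℂ) :
    Fin N → Fin N → Ω → ℂ :=
  fun i j ω => truncate (α * √N) (x i j ω)

theorem normalizedMatrix_truncateEntries {ω : Ω} (h : ∀ i j, ‖x i j ω‖ ≤ α * √N) :
    normalizedMatrix (truncateEntries α x) ω = normalizedMatrix x ω := by
  ext i j
  simp [normalizedMatrix, truncateEntries, truncate, h i j]

theorem norm_normalizedMatrix_truncateEntries_le (hα : 0 ≤ α) (i j : Fin N) (ω : Ω) :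
    ‖normalizedMatrix (truncateEntries α x) ω i j‖ ≤ α := by
  have hN : (0 : ℝ) < √N := by have := i.pos; positivity
  rw [normalizedMatrix, Matrix.of_apply, norm_mul, Complex.norm_of_nonneg (by positivity),
    inv_mul_le_iff₀ hN, mul_comm]
  exact norm_truncate_le (by positivity) _

theorem empiricalSpectralDistribution_congr {A A' : Matrix (Fin N) (Fin N) ℂ}
    (hA : A.IsHermitian) (hA' : A'.IsHermitian) (h : A = A') (t : ℝ) :
    empiricalSpectralDistribution hA t = empiricalSpectralDistribution hA' t := by
  subst h
  rfl

variable [MeasurableSpace Ω] {P : Measure Ω}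

theorem measurable_truncateEntries (hx : ∀ i j, Measurable (x i j)) (i j : Fin N) :
    Measurable (truncateEntries α x i j) :=
  (measurable_truncate _).comp (hx i j)

theorem measurable_normalizedMatrix (hx : ∀ i j, Measurable (x i j)) (i j : Fin N) :
    Measurable fun ω => normalizedMatrix x ω i j :=
  (hx i j).const_mul _

theorem measurable_powerMatrix (m : ℕ) (hx : ∀ i j, Measurable (x i j)) (i j : Fin N) :
    Measurable fun ω => powerMatrix m (normalizedMatrix x ω) i j := by
  have hX := measurable_normalizedMatrix hx
  exact measurable_matrix_mul (measurable_matrix_pow hX m)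
    (measurable_matrix_pow (fun i j => continuous_star.measurable.comp (hX j i)) m) i j

variable [NeZero N]

theorem empiricalSpectralDistribution_mem_Icc {A : Matrix (Fin N) (Fin N) ℂ}
    (hA : A.IsHermitian) (t : ℝ) : empiricalSpectralDistribution hA t ∈ Set.Icc 0 1 := by
  rw [← spectralMeasure_real_Iic]
  exact ⟨measureReal_nonneg, measureReal_le_one⟩

theorem measurable_empiricalSpectralDistribution {A : Ω → Matrix (Fin N) (Fin N) ℂ}
    (hA : ∀ ω, (A ω).IsHermitian) (hAm : ∀ i j, Measurable fun ω => A ω i j) (t : ℝ) :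
    Measurable fun ω => empiricalSpectralDistribution (hA ω) t := by
  simp only [← spectralMeasure_real_Iic, measureReal_def]
  exact ((Measure.measurable_coe measurableSet_Iic).comp
    (measurable_spectralMeasure hA hAm)).ennreal_toReal

theorem expectedSpectralMeasure_real_Iic_eq_expectedESD (hx : ∀ i j, Measurable (x i j)) (m : ℕ)
    (t : ℝ) :
    (expectedSpectralMeasure P fun ω =>
      powerMatrix_isHermitian m (normalizedMatrix x ω)).real (Set.Iic t) =
      expectedESD P x m t := by
  rw [expectedSpectralMeasure_real _ (measurable_powerMatrix m hx) measurableSet_Iic]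
  simp only [spectralMeasure_real_Iic, expectedESD]

theorem abs_expectedESD_sub_truncateEntries_le [IsFiniteMeasure P]
    (hx : ∀ i j, Measurable (x i j)) (hint : ∀ i j, Integrable (fun ω => ‖x i j ω‖ ^ 4) P)
    (hα : 0 < α) (m : ℕ) (t : ℝ) :
    |expectedESD P x m t - expectedESD P (truncateEntries α x) m t| ≤
      lindebergFourth P x α / α ^ 4 := by
  refine (abs_integral_sub_integral_le_measureReal_ne
    (measurable_empiricalSpectralDistribution _ (measurable_powerMatrix m hx) t)
    (measurable_empiricalSpectralDistribution _
      (measurable_powerMatrix m (measurable_truncateEntries hx)) t)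
    (fun _ => empiricalSpectralDistribution_mem_Icc _ t)
    fun _ => empiricalSpectralDistribution_mem_Icc _ t).trans
    ((measureReal_mono fun ω hω => ?_).trans
      (measureReal_exists_norm_gt_le_lindebergFourth hx hint hα))
  contrapose! hω
  simp only [Set.mem_ofPred_eq, not_exists, not_lt] at hω
  simp only [Set.mem_ofPred_eq, not_not]
  exact empiricalSpectralDistribution_congr _ _ (by rw [normalizedMatrix_truncateEntries hω]) t

end Comparison

section TruncatedTraces

variable {Ω : Type*} [MeasurableSpace Ω] {P : Measure Ω} {N : ℕ} {x : Fin N → Fin N → Ω → ℂ}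
  {α B : ℝ}

theorem iIndepFun_normalizedMatrix_truncateEntries
    (hind : iIndepFun (fun ij : Fin N × Fin N => x ij.1 ij.2) P) :
    iIndepFun (fun (e : Fin N × Fin N) ω =>
      normalizedMatrix (truncateEntries α x) ω e.1 e.2) P :=
  hind.comp (fun _ z => (((√N)⁻¹ : ℝ) : ℂ) * truncate (α * √N) z)
    fun _ => (measurable_truncate _).const_mul _

variable [IsProbabilityMeasure P] [NeZero N]

theorem isMomentTable_normalizedMatrix_truncateEntries
    (hx : ∀ i j, IsStandardized (x i j) P B) (hα : α ∈ Set.Ioc 0 1) :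
    IsMomentTable (N : ℝ)⁻¹ (α + (N : ℝ)⁻¹ * B / α ^ 3)
      (entryMoment P (normalizedMatrix (truncateEntries α x))) := by
  have h := IsStandardized.isMomentTable_entryMoment hx
    (inv_pos.2 (Real.sqrt_pos.2 (Nat.cast_pos.2 (NeZero.pos N)))) hα.1 hα.2
  rwa [inv_pow, Real.sq_sqrt N.cast_nonneg, div_inv_eq_mul] at h

theorem abs_expected_trace_sub_stackWeight_le (hx : ∀ i j, IsStandardized (x i j) P B)
    (hind : iIndepFun (fun ij : Fin N × Fin N => x ij.1 ij.2) P) (hα : α ∈ Set.Ioc 0 1)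
    (hθ : α + (N : ℝ)⁻¹ * B / α ^ 3 ≤ 1) (w : List Bool) :
    |(N : ℝ)⁻¹ * ∫ ω, (wordMatrix (normalizedMatrix (truncateEntries α x) ω) w).trace.re ∂P -
        stackWeight (N : ℝ)⁻¹ w 1 []| ≤
      ((w.length + 1) * (α + (N : ℝ)⁻¹ * B / α ^ 3) + (N : ℝ)⁻¹) * walkBound w.length 1 := by
  have hα0 := hα.1
  have hB := (hx 0 0).bound_nonneg
  have hX := measurable_normalizedMatrix
    (measurable_truncateEntries (α := α) fun i j => (hx i j).measurable)
  have hbound := norm_normalizedMatrix_truncateEntries_le (x := x) hα0.le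
  have hsum := (isMomentTable_normalizedMatrix_truncateEntries hx hα).norm_closedWalkSum_sub_le
    (by rw [Fintype.card_fin]; exact mul_inv_cancel₀ (NeZero.ne _)) (by positivity) hθ w
  rw [← integral_trace_wordMatrix hX hbound (iIndepFun_normalizedMatrix_truncateEntries hind) w]
    at hsum
  have hre := integral_re (integrable_trace_wordMatrix (μ := P) hX hbound w)
  simp only [RCLike.re_eq_complex_re] at hre
  rw [hre]
  refine le_trans (le_of_eq_of_le ?_ (Complex.abs_re_le_norm _)) hsum
  rw [Complex.sub_re, Complex.re_ofReal_mul, Complex.ofReal_re]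

end TruncatedTraces

/-! ### Convergence of the expected spectral distribution -/

section Diagonal

theorem exists_tendsto_atTop_forall_eventually {p : ℕ → ℕ → Prop}
    (h : ∀ k, ∀ᶠ n in atTop, p k n) :
    ∃ K : ℕ → ℕ, Tendsto K atTop atTop ∧ ∀ᶠ n in atTop, p (K n) n := by
  choose M hM using fun k => eventually_atTop.1 (h k)
  refine ⟨fun n => Nat.findGreatest (fun k => M k ≤ n) n, ?_, ?_⟩
  · exact tendsto_atTop_atTop.2 fun k => ⟨max k (M k), fun n hn =>
      Nat.le_findGreatest ((le_max_left _ _).trans hn) ((le_max_right _ _).trans hn)⟩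
  · filter_upwards [eventually_ge_atTop (M 0)] with n hn
    exact hM _ n (Nat.findGreatest_spec (P := fun k => M k ≤ n) n.zero_le hn)

theorem exists_tendsto_zero_tendsto_diagonal {X : Type*} [TopologicalSpace X]
    [FirstCountableTopology X] {a : X} {g : ℝ → ℕ → X}
    (hg : ∀ α > 0, Tendsto (g α) atTop (𝓝 a)) :
    ∃ α : ℕ → ℝ, (∀ n, α n ∈ Set.Ioc 0 1) ∧ Tendsto α atTop (𝓝 0) ∧
      Tendsto (fun n => g (α n) n) atTop (𝓝 a) := by
  obtain ⟨u, hu⟩ := (𝓝 a).exists_antitone_basis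
  obtain ⟨K, hK, hKu⟩ := exists_tendsto_atTop_forall_eventually fun k : ℕ =>
    (hg (1 / ((k : ℝ) + 1)) (by positivity)).eventually_mem (hu.mem k)
  refine ⟨fun n => 1 / ((K n : ℝ) + 1), fun n => ⟨by positivity, ?_⟩,
    tendsto_one_div_add_atTop_nhds_zero_nat.comp hK, hu.tendsto_right_iff.2 fun k _ => ?_⟩
  · exact (div_le_one (by positivity)).2 (le_add_of_nonneg_left (K n).cast_nonneg)
  · filter_upwards [hKu, hK.eventually_ge_atTop k] with n hn hk
    exact hu.antitone hk hn

end Diagonal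

section TruncatedLimit

variable {Ω : ℕ → Type*} [∀ N, MeasurableSpace (Ω N)] {P : ∀ N, Measure (Ω N)}
  [∀ N, IsProbabilityMeasure (P N)] {x : ∀ N, Fin N → Fin N → Ω N → ℂ} {B : ℝ} {α : ℕ → ℝ}

theorem tendsto_expected_trace_truncateEntries (hx : ∀ N i j, IsStandardized (x N i j) (P N) B)
    (hind : ∀ N, iIndepFun (fun ij : Fin N × Fin N => x N ij.1 ij.2) (P N))
    (hα : ∀ N, α N ∈ Set.Ioc 0 1)
    (hθ : Tendsto (fun N : ℕ => α N + (N : ℝ)⁻¹ * B / α N ^ 3) atTop (𝓝 0)) (w : List Bool) :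
    Tendsto (fun N : ℕ => (N : ℝ)⁻¹ *
      ∫ ω, (wordMatrix (normalizedMatrix (truncateEntries (α N) (x N)) ω) w).trace.re ∂P N)
      atTop (𝓝 (stackCount w [])) := by
  have hinv : Tendsto (fun N : ℕ => (N : ℝ)⁻¹) atTop (𝓝 0) := tendsto_inv_atTop_nhds_zero_nat
  have hweight := ((continuous_stackWeight w 1 []).tendsto 0).comp hinv
  rw [stackWeight_zero] at hweight
  have herror := ((hθ.const_mul ((w.length : ℝ) + 1)).add hinv).mul_const (walkBound w.length 1)
  rw [mul_zero, add_zero, zero_mul] at herror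
  refine hweight.congr_dist
    (squeeze_zero' (Eventually.of_forall fun _ => dist_nonneg) ?_ herror)
  filter_upwards [eventually_ne_atTop 0, hθ.eventually_le_const zero_lt_one] with N hN hθN
  have : NeZero N := ⟨hN⟩
  rw [dist_comm]
  exact abs_expected_trace_sub_stackWeight_le (hx N) (hind N) (hα N) hθN w

theorem tendsto_expectedESD_truncateEntries {m : ℕ} (hm : 1 ≤ m)
    (hx : ∀ N i j, IsStandardized (x N i j) (P N) B)
    (hind : ∀ N, iIndepFun (fun ij : Fin N × Fin N => x N ij.1 ij.2) (P N))
    (hα : ∀ N, α N ∈ Set.Ioc 0 1)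
    (hθ : Tendsto (fun N : ℕ => α N + (N : ℝ)⁻¹ * B / α N ^ 3) atTop (𝓝 0)) (t : ℝ) :
    Tendsto (fun N => expectedESD (P N) (truncateEntries (α N) (x N)) m t) atTop
      (𝓝 ((fussCatalanMeasure m).real (Set.Iic t))) := by
  have := isProbabilityMeasure_fussCatalanMeasure hm
  have := nullSingletonClass_fussCatalanMeasure hm
  have hym : ∀ N i j, Measurable (truncateEntries (α N) (x N) i j) := fun N =>
    measurable_truncateEntries fun i j => (hx N i j).measurable
  have hA := fun N ω =>
    powerMatrix_isHermitian m (normalizedMatrix (truncateEntries (α N) (x N)) ω)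
  have hAm := fun N => measurable_powerMatrix m (hym N)
  have hint : ∀ N p, Integrable (fun ω =>
      (powerMatrix m (normalizedMatrix (truncateEntries (α N) (x N)) ω) ^ p).trace) (P N) := by
    intro N p
    simp only [powerMatrix_pow_eq]
    exact integrable_trace_wordMatrix (measurable_normalizedMatrix (hym N))
      (norm_normalizedMatrix_truncateEntries_le (hα N).1.le) _
  have (n : ℕ) : IsProbabilityMeasure (expectedSpectralMeasure (P (n + 1)) (hA (n + 1))) :=
    isProbabilityMeasure_expectedSpectralMeasure _ (hAm (n + 1))
  have hmom : ∀ p, Tendsto (fun n =>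
      ∫ x, x ^ p ∂expectedSpectralMeasure (P (n + 1)) (hA (n + 1))) atTop
      (𝓝 (∫ x, x ^ p ∂fussCatalanMeasure m)) := by
    intro p
    have htrace := (tendsto_add_atTop_iff_nat 1).2
      (tendsto_expected_trace_truncateEntries hx hind hα hθ (blockWord m p))
    rw [integral_pow_fussCatalanMeasure hm, ← stackCount_blockWord hm]
    refine htrace.congr fun n => ?_
    rw [integral_pow_expectedSpectralMeasure _ (hAm (n + 1)) (hint (n + 1)), Fintype.card_fin]
    simp only [powerMatrix_pow_eq]
  have hcdf := tendsto_measureReal_Iic_of_tendsto_moments (ae_abs_le_fussCatalanMeasure hm)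
    (fun n p => integrable_pow_expectedSpectralMeasure _ (hAm (n + 1)) (hint (n + 1)) p) hmom t
  simp only [expectedSpectralMeasure_real_Iic_eq_expectedESD (hym _)] at hcdf
  exact (tendsto_add_atTop_iff_nat 1).1 hcdf

end TruncatedLimit

namespace EntryConditions

variable {Ω : ℕ → Type*} [∀ N, MeasurableSpace (Ω N)] {P : ∀ N, Measure (Ω N)}
  {x : ∀ N, Fin N → Fin N → Ω N → ℂ}

theorem exists_isStandardized (hx : EntryConditions P x) :
    ∃ B, ∀ N i j, IsStandardized (x N i j) (P N) B := by
  obtain ⟨B, hB⟩ := hx.fourth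
  exact ⟨B, fun N i j => ⟨hx.measurable N i j, hx.mean N i j, hx.variance N i j,
    (hB N i j).1, (hB N i j).2⟩⟩

theorem exists_truncation_level (hx : EntryConditions P x) (B : ℝ) :
    ∃ α : ℕ → ℝ, (∀ N, α N ∈ Set.Ioc 0 1) ∧
      Tendsto (fun N : ℕ => α N + (N : ℝ)⁻¹ * B / α N ^ 3) atTop (𝓝 0) ∧
      Tendsto (fun N => lindebergFourth (P N) (x N) (α N) / α N ^ 4) atTop (𝓝 0) := by
  obtain ⟨α, hα, hα0, hdiag⟩ := exists_tendsto_zero_tendsto_diagonal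
    (g := fun α N => (lindebergFourth (P N) (x N) α / α ^ 4, (N : ℝ)⁻¹ * B / α ^ 3))
    (a := (0, 0)) fun α hα => by
      refine .prodMk_nhds ?_ ?_
      · simpa using (hx.lindeberg α hα).div_const (α ^ 4)
      · simpa using (tendsto_inv_atTop_nhds_zero_nat.mul_const B).div_const (α ^ 3)
  exact ⟨α, hα, by simpa using hα0.add hdiag.snd_nhds, hdiag.fst_nhds⟩

theorem tendsto_expectedESD [∀ N, IsProbabilityMeasure (P N)] {m : ℕ} (hm : 1 ≤ m)
    (hx : EntryConditions P x) (t : ℝ) :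
    Tendsto (fun N => expectedESD (P N) (x N) m t) atTop
      (𝓝 ((fussCatalanMeasure m).real (Set.Iic t))) := by
  obtain ⟨B, hB⟩ := hx.exists_isStandardized
  obtain ⟨α, hα, hθ, hlindeberg⟩ := hx.exists_truncation_level B
  have htruncated := tendsto_expectedESD_truncateEntries hm hB hx.indep hα hθ t
  have hdiff : Tendsto (fun N => expectedESD (P N) (x N) m t -
      expectedESD (P N) (truncateEntries (α N) (x N)) m t) atTop (𝓝 0) := by
    refine squeeze_zero_norm' ?_ hlindeberg
    filter_upwards [eventually_ne_atTop 0] with N hN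
    have : NeZero N := ⟨hN⟩
    exact abs_expectedESD_sub_truncateEntries_le (fun i j => (hB N i j).measurable)
      (fun i j => (hB N i j).integrable_fourth) (hα N).1 m t
  simpa using hdiff.add htruncated

end EntryConditions

theorem theorem1 (m : ℕ) (hm : 1 ≤ m) :
    ∃ G : StieltjesFunction ℝ,
      (Tendsto G atBot (𝓝 0) ∧ Tendsto G atTop (𝓝 1)) ∧
      (∀ p : ℕ, Integrable (fun s : ℝ => s ^ p) G.measure ∧
        ∫ s : ℝ, s ^ p ∂G.measure =
          1 / ((m : ℝ) * (p : ℝ) + 1) * (Nat.choose (m * p + p) p : ℝ)) ∧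
      ∀ (Ω : ℕ → Type*) [∀ N, MeasurableSpace (Ω N)] (P : ∀ N, Measure (Ω N))
        [∀ N, IsProbabilityMeasure (P N)] (x : ∀ N, Fin N → Fin N → Ω N → ℂ),
        EntryConditions P x →
        ∀ t : ℝ, Tendsto (fun N => expectedESD (P N) (x N) m t) atTop (𝓝 (G t)) := by
  have := isProbabilityMeasure_fussCatalanMeasure hm
  refine ⟨cdf (fussCatalanMeasure m), ⟨tendsto_cdf_atBot _, tendsto_cdf_atTop _⟩, fun p => ?_,
    fun Ω _ P _ x hx t => ?_⟩
  · rw [measure_cdf]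
    exact ⟨integrable_pow_of_ae_abs_le (ae_abs_le_fussCatalanMeasure hm) p,
      integral_pow_fussCatalanMeasure hm p⟩
  · rw [cdf_eq_real]
    exact hx.tendsto_expectedESD hm t
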